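/- Let $\pi:Q\to\mathbb R$ be a smooth fibre bundle over the time axis with $m$-dimensional typical fibre, with bundle coordinates $(t,q^i)$; let $J^1Q\to Q$ be its affine jet bundle (the vectors $v\in TQ$ with $dt(v)=1$, coordinates $(t,q^i,q^i_t)$), modelled over the vertical bundle $VQ$, and let $V^*Q$ be the dual of $VQ$, with coordinates $(t,q^i,p_i)$. Let $L=\mathcal L\,dt$ be a smooth quadratic Lagrangian, i.e. in bundle coordinates $$\mathcal L=\tfrac12 a_{ij}q^i_tq^j_t+b_iq^i_t+c,\qquad a_{ij}=a_{ji},$$ with $a_{ij},b_i,c$ local smooth functions on $Q$. Let $\widehat L:J^1Q\to V^*Q$, $p_i\circ\widehat L=a_{ij}q^j_t+b_i$, be the Legendre map, $N_L=\widehat L(J^1Q)$ the Lagrangian constraint space, $i_N:N_L\to V^*Q$ its inclusion, and $\overline L:VQ\to V^*Q$, $p_i\circ\overline L=a_{ij}\dot q^j$. Assume that $a$ has constant rank ($L$ is almost regular) and that $N_L$ contains the zero section of $V^*Q\to Q$. A Hamiltonian form is a 1-form $H=p_i\,dq^i-\mathcal H\,dt$ on $V^*Q$ which is the pull-back of the Liouville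 form of $T^*Q$ by a smooth section of $T^*Q\to V^*Q$. Its Hamiltonian map is $\widehat H=\partial_t+\frac{\partial\mathcal H}{\partial p_i}\partial_i:V^*Q\to J^1Q$, and its Hamilton equations are $q^i_t=\partial\mathcal H/\partial p_i$, $p_{ti}=-\partial\mathcal H/\partial q^i$. For a bundle map $\Phi:V^*Q\to J^1Q$ over $Q$ put $H_\Phi=p_i\,dq^i-p_i\Phi^i\,dt$ and $\Phi^*L=\mathcal L(t,q^i,\Phi^i)\,dt$. A Hamiltonian form $H$ is weakly associated with $L$ if $\widehat L\circ\widehat H\circ\widehat L=\widehat L$ and $H=H_{\widehat H}+\widehat H^*L$ at all points of $N_L$. A set of weakly associated Hamiltonian forms is complete if for every smooth solution $c:\mathbb R\to Q$ of the Lagrange equations there are an $H$ in the set and a smooth solution $r:\mathbb R\to V^*Q$ of the Hamilton equations for $H$ that projects onto $c$. Then there exist a smooth linear bundle map $\sigma:V^*Q\to VQ$ over $Q$, $\dot q^i\circ\sigma=\sigma^{ij}p_j$, with $\overline L\circ\sigma\circ i_N=i_N$ (it can be chosen symmetric, $\sigma^{ij}=\sigma^{ji}$), and a smooth connection $\Gamma:Q\to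 J^1Q$ with $\widehat L\circ\Gamma=0$, i.e. $a_{ij}\Gamma^j+b_i=0$. For every such $\sigma$: 1. for every such $\Gamma$, the form $H=H_\Phi+\Phi^*L$ defined by $\Phi=\Gamma+\sigma$, $\Phi^i=\Gamma^i+\sigma^{ij}p_j$, is a Hamiltonian form weakly associated with $L$; 2. for fixed $\sigma$, these forms, parameterized by all such $\Gamma$, constitute a complete set. -/

import Mathlib

open scoped Manifold ContDiff Matrix

noncomputable section

/-- The space of bundle coordinates `(t, q^1, …, q^m)`. -/
abbrev Coord (m : ℕ) : Type := ℝ × (Fin m → ℝ)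

/-- `π : Q → ℝ` is a smooth (locally trivial) fibre bundle over the time axis with `m`-dimensional
typical fibre `M`. -/
def IsSmoothFibreBundle (m : ℕ) {Q : Type*} [TopologicalSpace Q] [ChartedSpace (Coord m) Q]
    (M : Type*) [TopologicalSpace M] [ChartedSpace (Fin m → ℝ) M] (π : Q → ℝ) : Prop :=
  ∀ t : ℝ, ∃ e : Bundle.Trivialization M π, t ∈ e.baseSet ∧
    ContMDiffOn 𝓘(ℝ, Coord m) (𝓘(ℝ, ℝ).prod 𝓘(ℝ, Fin m → ℝ)) ∞
      e.toOpenPartialHomeomorph e.source ∧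
    ContMDiffOn (𝓘(ℝ, ℝ).prod 𝓘(ℝ, Fin m → ℝ)) 𝓘(ℝ, Coord m) ∞
      e.toOpenPartialHomeomorph.symm e.target

section Bundles

variable (m : ℕ) {Q : Type*} [TopologicalSpace Q] [ChartedSpace (Coord m) Q] (π : Q → ℝ)

/-- The 1-form `dt` on `Q` (the pull-back of the standard 1-form on `ℝ`), at the point `q`. -/
def dtForm (q : Q) : TangentSpace 𝓘(ℝ, Coord m) q →ₗ[ℝ] ℝ :=
  (mfderiv 𝓘(ℝ, Coord m) 𝓘(ℝ, ℝ) π q).toLinearMap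

/-- The fibre `V_q Q` of the vertical tangent bundle. -/
abbrev Vert (q : Q) : Submodule ℝ (TangentSpace 𝓘(ℝ, Coord m) q) :=
  LinearMap.ker (dtForm m π q)

/-- The fibre of `J¹Q → Q`: the affine space of tangent vectors `v` with `v ⌋ dt = 1`. -/
abbrev JetFibre (q : Q) : Type :=
  {v : TangentSpace 𝓘(ℝ, Coord m) q // dtForm m π q v = 1}

/-- The fibre `V*_q Q` of the Legendre bundle. -/
abbrev MomFibre (q : Q) : Type :=
  Module.Dual ℝ (Vert m π q)

/-- The total space of the Legendre bundle `V*Q`. -/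
abbrev LegendreBundle : Type _ := Σ q : Q, MomFibre m π q

/-- A Lagrangian `L = 𝓛 dt`, given by the function `𝓛` on `J¹Q`. -/
abbrev Lagrangian : Type _ := ∀ q : Q, JetFibre m π q → ℝ

/-- Maps `h : V*Q → T*Q` over `Q`. Such an `h` stands for the 1-form `h*Ξ` on `V*Q`, where `Ξ` is
the Liouville form; see `IsHamiltonianForm`. -/
abbrev CotangentMap : Type _ :=
  ∀ q : Q, MomFibre m π q → Module.Dual ℝ (TangentSpace 𝓘(ℝ, Coord m) q)

/-- Bundle coordinates `(t, q^i)` on `Q → ℝ`. -/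
def IsBundleChart (φ : OpenPartialHomeomorph Q (Coord m)) : Prop :=
  φ ∈ IsManifold.maximalAtlas 𝓘(ℝ, Coord m) ∞ Q ∧ ∀ q ∈ φ.source, (φ q).1 = π q

end Bundles

section Fibrewise

variable {m : ℕ} {Q : Type*} [TopologicalSpace Q] [ChartedSpace (Coord m) Q] {π : Q → ℝ}

/-- `J¹Q → Q` is an affine bundle modelled over `VQ`. -/
def JetFibre.add {q : Q} (j : JetFibre m π q) (v : Vert m π q) : JetFibre m π q :=
  ⟨j.1 + v.1, by rw [map_add, j.2, LinearMap.mem_ker.mp v.2, add_zero]⟩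

/-- The projection `T_q Q → V_q Q`, `w ↦ w - dt(w) j`, defined by a jet `j`. -/
def vertProj {q : Q} (j : JetFibre m π q) :
    TangentSpace 𝓘(ℝ, Coord m) q →ₗ[ℝ] Vert m π q :=
  LinearMap.codRestrict (Vert m π q)
    (LinearMap.id - (dtForm m π q).smulRight j.1) (fun w => by
      simp [LinearMap.mem_ker, j.2])

open Classical in
/-- The Legendre map `L̂ : J¹Q → V*Q`, `p_i ∘ L̂ = ∂𝓛/∂q^i_t`, i.e. the derivative of `𝓛` along the
fibres of `J¹Q → Q`. (The value is `0` where that derivative does not exist.) -/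
def legendre (L : Lagrangian m π) (q : Q) (j : JetFibre m π q) : MomFibre m π q :=
  if h : ∃ p : MomFibre m π q, ∀ v : Vert m π q,
      HasDerivAt (fun s : ℝ => L q (j.add (s • v))) (p v) 0
  then h.choose else 0

/-- The fibre over `q` of the Lagrangian constraint space `N_L = L̂(J¹Q)`. -/
def constraintSpace (L : Lagrangian m π) (q : Q) : Set (MomFibre m π q) :=
  Set.range (legendre L q)

/-- `H_Φ + Φ*L` for a bundle map `Φ : V*Q → J¹Q` over `Q`, where
`H_Φ = - Φ ⌋ Θ = p_i dq^i - p_i Φ^i dt`. -/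
def formOfMap (L : Lagrangian m π) (Φ : ∀ q : Q, MomFibre m π q → JetFibre m π q) :
    CotangentMap m π :=
  fun q z => z ∘ₗ vertProj (Φ q z) + L q (Φ q z) • dtForm m π q

/-- The map `Φ = Γ + σ : V*Q → J¹Q`. -/
def affineMap (Γ : ∀ q : Q, JetFibre m π q) (σ : ∀ q : Q, MomFibre m π q →ₗ[ℝ] Vert m π q) :
    ∀ q : Q, MomFibre m π q → JetFibre m π q :=
  fun q z => (Γ q).add (σ q z)

end Fibrewise

section Coordinates

variable {m : ℕ} {Q : Type*} [TopologicalSpace Q] [ChartedSpace (Coord m) Q] {π : Q → ℝ}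

/-- The components `v^i` of a tangent vector `v` relative to a chart `(t, q^i)`; for a jet these are
the coordinates `q^i_t`. -/
def velCoord (φ : OpenPartialHomeomorph Q (Coord m)) (q : Q) :
    TangentSpace 𝓘(ℝ, Coord m) q →ₗ[ℝ] (Fin m → ℝ) :=
  LinearMap.snd ℝ ℝ (Fin m → ℝ) ∘ₗ
    (mfderiv 𝓘(ℝ, Coord m) 𝓘(ℝ, Coord m) φ q).toLinearMap

/-- The tangent vector `x^t ∂_t + x^i ∂_i` at the point of `Q` with coordinates `y`. -/
def coordVec (φ : OpenPartialHomeomorph Q (Coord m)) (y : Coord m) (x : Coord m) :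
    TangentSpace 𝓘(ℝ, Coord m) (φ.symm y) :=
  mfderiv 𝓘(ℝ, Coord m) 𝓘(ℝ, Coord m) φ.symm y x

/-- The element `p_i d̄q^i` of `V*_q Q` with momentum coordinates `p_i`. -/
def momOf (φ : OpenPartialHomeomorph Q (Coord m)) (q : Q) (p : Fin m → ℝ) : MomFibre m π q :=
  (∑ i, p i • LinearMap.proj i) ∘ₗ velCoord φ q ∘ₗ (Vert m π q).subtype

/-- On the domain of a bundle chart, `(x^t ∂_t + x^i ∂_i) ⌋ dt = x^t`. -/
theorem dtForm_coordVec [IsManifold 𝓘(ℝ, Coord m) ∞ Q]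
    {φ : OpenPartialHomeomorph Q (Coord m)} (hφ : IsBundleChart m π φ)
    {y : Coord m} (hy : y ∈ φ.target) (x : Coord m) :
    dtForm m π (φ.symm y) (coordVec φ y x) = x.1 := by
  have hs : φ.symm y ∈ φ.source := φ.map_target hy
  have h1 : MDifferentiableAt 𝓘(ℝ, Coord m) 𝓘(ℝ, Coord m) φ.symm y :=
    (contMDiffOn_symm_of_mem_maximalAtlas hφ.1).contMDiffAt (φ.open_target.mem_nhds hy)
      |>.mdifferentiableAt (by simp)
  have h2 : MDifferentiableAt 𝓘(ℝ, Coord m) 𝓘(ℝ, Coord m) φ (φ.symm y) :=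
    (contMDiffOn_of_mem_maximalAtlas hφ.1).contMDiffAt (φ.open_source.mem_nhds hs)
      |>.mdifferentiableAt (by simp)
  have h3 : MDifferentiableAt 𝓘(ℝ, Coord m) 𝓘(ℝ, ℝ) (fun q => (φ q).1) (φ.symm y) :=
    (mdifferentiableAt_iff_differentiableAt.mpr differentiableAt_fst).comp _ h2
  have h4 : π =ᶠ[nhds (φ.symm y)] fun q => (φ q).1 := by
    filter_upwards [φ.open_source.mem_nhds hs] with q hq using (hφ.2 q hq).symm
  have h5 : MDifferentiableAt 𝓘(ℝ, Coord m) 𝓘(ℝ, ℝ) π (φ.symm y) :=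
    h3.congr_of_eventuallyEq h4
  have h6 : (π ∘ φ.symm) =ᶠ[nhds y] (Prod.fst : Coord m → ℝ) := by
    filter_upwards [φ.open_target.mem_nhds hy] with w hw
    simp [← hφ.2 _ (φ.map_target hw), φ.right_inv hw]
  have h7 := mfderiv_comp y h5 h1
  rw [h6.mfderiv_eq, mfderiv_eq_fderiv] at h7
  have h8 := congrArg (fun f => f x) h7
  have h9 : fderiv ℝ (Prod.fst : Coord m → ℝ) y x = x.1 := by
    rw [fderiv_fst]; rfl
  exact h8.symm.trans h9

open Classical in
/-- The coordinate expression `𝓛(t, q^i, q^i_t)` of a Lagrangian in a bundle chart.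
By `dtForm_coordVec` the first case holds for all `y ∈ φ.target`. -/
def coordLagrangian (L : Lagrangian m π) (φ : OpenPartialHomeomorph Q (Coord m))
    (y : Coord m) (w : Fin m → ℝ) : ℝ :=
  if h : dtForm m π (φ.symm y) (coordVec φ y (1, w)) = 1
  then L (φ.symm y) ⟨coordVec φ y (1, w), h⟩ else 0

/-- The coordinate expression `𝓗(t, q^i, p_i)` of `H = p_i dq^i - 𝓗 dt` in a bundle chart, i.e.
`-𝓗` is the value of the covector `h(t, q, p)` on `∂_t`. -/
def coordHamiltonian (H : CotangentMap m π) (φ : OpenPartialHomeomorph Q (Coord m))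
    (y : Coord m) (p : Fin m → ℝ) : ℝ :=
  -(H (φ.symm y) (momOf φ (φ.symm y) p) (coordVec φ y (1, 0)))

/-- The partial derivative `∂f/∂x^i` at `x`. -/
def partialDeriv (f : (Fin m → ℝ) → ℝ) (i : Fin m) (x : Fin m → ℝ) : ℝ :=
  fderiv ℝ f x (Pi.single i 1)

end Coordinates

section Mechanics

variable {m : ℕ} {Q : Type*} [TopologicalSpace Q] [ChartedSpace (Coord m) Q] {π : Q → ℝ}

/-- `L` is a quadratic Lagrangian: in every bundle chart
`𝓛 = ½ a_ij q^i_t q^j_t + b_i q^i_t + c` with smooth functions `a_ij = a_ji`, `b_i`, `c` on the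
domain of the chart. The matrices `a_ij` are the components of the symmetric fibre form `a` in `VQ`,
regarded as the linear bundle map `L̄ : VQ → V*Q`, `p_i ∘ L̄ = a_ij q̇^j`. -/
def IsQuadratic (L : Lagrangian m π) (a : ∀ q : Q, Vert m π q →ₗ[ℝ] MomFibre m π q) : Prop :=
  ∀ φ : OpenPartialHomeomorph Q (Coord m), IsBundleChart m π φ →
    ∃ (A : Coord m → Matrix (Fin m) (Fin m) ℝ) (b : Coord m → Fin m → ℝ) (c : Coord m → ℝ),
      (∀ i j, ContDiffOn ℝ ∞ (fun y => A y i j) φ.target) ∧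
      ContDiffOn ℝ ∞ b φ.target ∧ ContDiffOn ℝ ∞ c φ.target ∧
      (∀ y ∈ φ.target, (A y).IsSymm) ∧
      (∀ q ∈ φ.source, ∀ u v : Vert m π q,
        a q u v = velCoord φ q u ⬝ᵥ A (φ q) *ᵥ velCoord φ q v) ∧
      (∀ q ∈ φ.source, ∀ j : JetFibre m π q,
        L q j = 1 / 2 * (velCoord φ q j.1 ⬝ᵥ A (φ q) *ᵥ velCoord φ q j.1) +
          b (φ q) ⬝ᵥ velCoord φ q j.1 + c (φ q))

/-- A (smooth) connection on `Q → ℝ`, i.e. a smooth section of `J¹Q → Q`. -/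
def IsConnection [IsManifold 𝓘(ℝ, Coord m) ∞ Q] (Γ : ∀ q : Q, JetFibre m π q) : Prop :=
  ContMDiff 𝓘(ℝ, Coord m) 𝓘(ℝ, Coord m).tangent ∞
    (fun q => (⟨q, (Γ q).1⟩ : TangentBundle 𝓘(ℝ, Coord m) Q))

/-- A connection on `Q → ℝ` with values in `Ker L̂`. -/
def IsKernelConnection [IsManifold 𝓘(ℝ, Coord m) ∞ Q] (L : Lagrangian m π)
    (Γ : ∀ q : Q, JetFibre m π q) : Prop :=
  IsConnection Γ ∧ ∀ q, legendre L q (Γ q) = 0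

/-- A smooth linear bundle map `σ : V*Q → VQ` over `Q`, `q̇^i ∘ σ = σ^{ij} p_j`. -/
def IsSmoothBundleMap (σ : ∀ q : Q, MomFibre m π q →ₗ[ℝ] Vert m π q) : Prop :=
  ∀ φ : OpenPartialHomeomorph Q (Coord m), IsBundleChart m π φ →
    ∃ S : Coord m → Matrix (Fin m) (Fin m) ℝ,
      (∀ i j, ContDiffOn ℝ ∞ (fun y => S y i j) φ.target) ∧
      ∀ q ∈ φ.source, ∀ p : Fin m → ℝ, velCoord φ q (σ q (momOf φ q p)) = S (φ q) *ᵥ p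

/-- A smooth linear bundle map `σ : V*Q → VQ` with `L̄ ∘ σ ∘ i_N = i_N`, where `i_N` is the inclusion
of the Lagrangian constraint space. -/
def IsSigmaMap (L : Lagrangian m π) (a : ∀ q : Q, Vert m π q →ₗ[ℝ] MomFibre m π q)
    (σ : ∀ q : Q, MomFibre m π q →ₗ[ℝ] Vert m π q) : Prop :=
  IsSmoothBundleMap σ ∧ ∀ q, ∀ z ∈ constraintSpace L q, a q (σ q z) = z

/-- `H = h*Ξ` is a Hamiltonian form: `h` is a smooth section of the bundle `T*Q → V*Q`. -/
def IsHamiltonianForm (H : CotangentMap m π) : Prop :=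
  (∀ (q : Q) (z : MomFibre m π q) (v : Vert m π q), H q z v.1 = z v) ∧
  ∀ φ : OpenPartialHomeomorph Q (Coord m), IsBundleChart m π φ →
    ContDiffOn ℝ ∞ (fun yp : Coord m × (Fin m → ℝ) => coordHamiltonian H φ yp.1 yp.2)
      (φ.target ×ˢ Set.univ)

/-- `Ψ = Ĥ` is the Hamiltonian map `∂_t + (∂𝓗/∂p_i) ∂_i : V*Q → J¹Q` of `H`. -/
def IsHamiltonianMap (H : CotangentMap m π) (Ψ : ∀ q : Q, MomFibre m π q → JetFibre m π q) :
    Prop :=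
  ∀ φ : OpenPartialHomeomorph Q (Coord m), IsBundleChart m π φ →
    ∀ q ∈ φ.source, ∀ (p : Fin m → ℝ) (i : Fin m),
      velCoord φ q (Ψ q (momOf φ q p)).1 i = partialDeriv (coordHamiltonian H φ (φ q)) i p

/-- The Hamiltonian form `H` is weakly associated with `L`: `L̂ ∘ Ĥ ∘ L̂ = L̂`, and
`H = H_Ĥ + Ĥ*L` at all points of the Lagrangian constraint space. -/
def IsWeaklyAssociated (L : Lagrangian m π) (H : CotangentMap m π) : Prop :=
  IsHamiltonianForm H ∧ ∃ Ψ : ∀ q : Q, MomFibre m π q → JetFibre m π q,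
    IsHamiltonianMap H Ψ ∧
    (∀ (q : Q) (j : JetFibre m π q), legendre L q (Ψ q (legendre L q j)) = legendre L q j) ∧
    (∀ q, ∀ z ∈ constraintSpace L q, H q z = formOfMap L Ψ q z)

/-- A smooth section `c : ℝ → Q`. -/
def IsSmoothSection (m : ℕ) {Q : Type*} [TopologicalSpace Q] [ChartedSpace (Coord m) Q]
    (π : Q → ℝ) (c : ℝ → Q) : Prop :=
  ContMDiff 𝓘(ℝ, ℝ) 𝓘(ℝ, Coord m) ∞ c ∧ ∀ t, π (c t) = t

/-- The section `c` of `Q → ℝ` is a solution of the Lagrange equations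
`d/dt (∂𝓛/∂q^i_t) = ∂𝓛/∂q^i`. -/
def IsLagrangeSolution (L : Lagrangian m π) (c : ℝ → Q) : Prop :=
  IsSmoothSection m π c ∧
  ∀ φ : OpenPartialHomeomorph Q (Coord m), IsBundleChart m π φ →
    ∀ t : ℝ, c t ∈ φ.source → ∀ i : Fin m,
      deriv (fun s => partialDeriv (coordLagrangian L φ (φ (c s))) i
          (deriv (fun τ => (φ (c τ)).2) s)) t =
        partialDeriv (fun x => coordLagrangian L φ (t, x) (deriv (fun τ => (φ (c τ)).2) t)) i
          (φ (c t)).2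

/-- The section `r` of `V*Q → ℝ` is smooth and is a solution of the Hamilton equations
`q^i_t = ∂𝓗/∂p_i`, `p_{ti} = -∂𝓗/∂q^i`. In each bundle chart, `p` lists the (unique) momentum
coordinates of `r`. -/
def IsHamiltonSolution (H : CotangentMap m π) (r : ℝ → LegendreBundle m π) : Prop :=
  IsSmoothSection m π (fun t => (r t).1) ∧
  ∀ φ : OpenPartialHomeomorph Q (Coord m), IsBundleChart m π φ →
    ∃ p : ℝ → Fin m → ℝ, ContDiffOn ℝ ∞ p {t | (r t).1 ∈ φ.source} ∧
      ∀ t : ℝ, (r t).1 ∈ φ.source →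
        (r t).2 = momOf φ (r t).1 (p t) ∧
        ∀ i : Fin m,
          deriv (fun s => (φ (r s).1).2 i) t =
            partialDeriv (coordHamiltonian H φ (φ (r t).1)) i (p t) ∧
          deriv (fun s => p s i) t =
            -partialDeriv (fun x => coordHamiltonian H φ (t, x) (p t)) i (φ (r t).1).2

/-- A set `S` of Hamiltonian forms (weakly associated with `L`) is complete if every solution `c`
of the Lagrange equations is the projection of a solution `r` of the Hamilton equations for some
`H` in `S`. -/
def IsCompleteSet (L : Lagrangian m π) (S : Set (CotangentMap m π)) : Prop :=
  ∀ c : ℝ → Q, IsLagrangeSolution L c →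
    ∃ H ∈ S, ∃ r : ℝ → LegendreBundle m π,
      IsHamiltonSolution H r ∧ ∀ t, (r t).1 = c t

end Mechanics

end

/-! In each fibre the Legendre map is affine with linear part `a`. Since `0` lies in its image, that
image is the range of `a`, so on symmetric `σ` the condition on `N_L` is the generalized inverse
equation `a σ a = a`. Constant rank gives local smooth symmetric solutions `U (Uᵀ A U)⁻¹ Uᵀ`
(`exists_local_symm_generalized_inverse`). Because `a σ a = a` is affine in `σ` and symmetry is
linear, a partition of unity glues them (`IsQuadratic.exists_smooth_symmGeneralizedInverse`).

Given any admissible `σ`, symmetric or not, every connection `Γ₀` yields the kernel connection `Γ₀ -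
σ(L̂ Γ₀)`, because `L̂ Γ₀ - a σ L̂ Γ₀ = 0` (`IsConnection.isKernelConnection_sub`).

For `Φ = Γ + σ` the Hamiltonian is `p · Φ(p) - 𝓛(Φ(p))`, and its fibre derivative is `Φ(p) + σᵀ(p -
L̂ Φ(p))` (`IsQuadraticIn.partialDeriv_coordHamiltonian`). If `Γ` is a kernel connection, then `L̂
Φ(p) = a σ p`, which equals `p` on `N_L`. There the Hamiltonian map is `Φ` itself, and weak
association follows.

For completeness, extend the velocity of a Lagrange solution `c` to a connection `Γ₀`, which is
possible because the image of a section is closed, and put `Γ = Γ₀ - σ(L̂ Γ₀)` and `r = L̂(ċ)`. Then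
`Φ(r) = ċ` and `L̂ Φ(r) = r`, which gives the first Hamilton equation. Moreover `ċ` is a critical
point of `w ↦ r · w - 𝓛(w)`, so the dependence of `Φ` on `q` does not contribute to `∂𝓗/∂q = -∂𝓛/∂q`
(`IsQuadraticIn.partialDeriv_coordHamiltonian_base`), and the Lagrange equations become the second
Hamilton equation. -/

/-! ### Bundle charts and the coordinates of vectors, jets and momenta. -/

section BundleCharts

variable {m : ℕ} {Q : Type*} [TopologicalSpace Q] [ChartedSpace (Coord m) Q] {π : Q → ℝ}

/-- A smooth fibre bundle over the time axis has bundle coordinates around every point. -/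
theorem IsSmoothFibreBundle.exists_isBundleChart [IsManifold 𝓘(ℝ, Coord m) ∞ Q]
    {M : Type*} [TopologicalSpace M] [ChartedSpace (Fin m → ℝ) M]
    [IsManifold 𝓘(ℝ, Fin m → ℝ) ∞ M] (hπ : IsSmoothFibreBundle m M π) (q : Q) :
    ∃ φ : OpenPartialHomeomorph Q (Coord m), IsBundleChart m π φ ∧ q ∈ φ.source := by
  obtain ⟨e, he, h1, h2⟩ := hπ (π q)
  have hqe : q ∈ e.source := e.mem_source.mpr he
  let ψ := chartAt (Fin m → ℝ) (e q).2
  -- Only the fibre factor is composed with a chart of `M`; the identity on the time factor keeps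
  -- the first coordinate equal to `π`.
  let φ : OpenPartialHomeomorph Q (Coord m) :=
    e.toOpenPartialHomeomorph.trans ((OpenPartialHomeomorph.refl ℝ).prod ψ)
  have hs : ∀ x, x ∈ φ.source ↔ x ∈ e.source ∧ (e x).2 ∈ ψ.source := by
    intro x
    simp [φ]
  have ht : ∀ y, y ∈ φ.target ↔ y.2 ∈ ψ.target ∧ (y.1, ψ.symm y.2) ∈ e.target := by
    intro y
    simp [φ]
  refine ⟨φ, ⟨OpenPartialHomeomorph.mem_maximalAtlas_of_contMDiffOn φ ?_ ?_, ?_⟩, ?_⟩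
  · have hψ : ContMDiffOn 𝓘(ℝ, Fin m → ℝ) 𝓘(ℝ, Fin m → ℝ) ∞ ψ ψ.source := contMDiffOn_chart
    have h1' := h1.mono (fun x hx => ((hs x).mp hx).1 : φ.source ⊆ e.source)
    exact (contMDiff_fst.comp_contMDiffOn h1').prodMk_space
      (hψ.comp (contMDiff_snd.comp_contMDiffOn h1') fun x hx => ((hs x).mp hx).2)
  · have hψ : ContMDiffOn 𝓘(ℝ, Fin m → ℝ) 𝓘(ℝ, Fin m → ℝ) ∞ ψ.symm ψ.target :=
      contMDiffOn_chart_symm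
    have h3 : ContMDiffOn 𝓘(ℝ, Coord m) 𝓘(ℝ, ℝ) ∞ (Prod.fst : Coord m → ℝ) φ.target :=
      contDiff_fst.contMDiff.contMDiffOn
    have h4 : ContMDiffOn 𝓘(ℝ, Coord m) 𝓘(ℝ, Fin m → ℝ) ∞
        (fun y : Coord m => ψ.symm y.2) φ.target :=
      hψ.comp contDiff_snd.contMDiff.contMDiffOn fun y hy => ((ht y).mp hy).1
    exact h2.comp (h3.prodMk h4) fun y hy => ((ht y).mp hy).2
  · intro x hx
    exact e.coe_fst ((hs x).mp hx).1
  · exact (hs q).mpr ⟨hqe, mem_chart_source _ _⟩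

variable {φ ψ : OpenPartialHomeomorph Q (Coord m)} {q : Q}

namespace IsBundleChart

theorem mdifferentiable [IsManifold 𝓘(ℝ, Coord m) ∞ Q] (hφ : IsBundleChart m π φ) :
    φ.MDifferentiable 𝓘(ℝ, Coord m) 𝓘(ℝ, Coord m) :=
  ⟨(contMDiffOn_of_mem_maximalAtlas hφ.1).mdifferentiableOn (by simp),
    (contMDiffOn_symm_of_mem_maximalAtlas hφ.1).mdifferentiableOn (by simp)⟩

/-- Coordinates of tangent vectors in a bundle chart. -/
noncomputable def tangentEquiv [IsManifold 𝓘(ℝ, Coord m) ∞ Q] (hφ : IsBundleChart m π φ)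
    (hq : q ∈ φ.source) : TangentSpace 𝓘(ℝ, Coord m) q ≃ₗ[ℝ] Coord m :=
  have : IsManifold 𝓘(ℝ, Coord m) 1 Q := IsManifold.of_le (n := ∞) (by simp)
  (hφ.mdifferentiable.mfderiv hq).toLinearEquiv

variable [IsManifold 𝓘(ℝ, Coord m) ∞ Q] (hφ : IsBundleChart m π φ) (hq : q ∈ φ.source)
include hφ hq

theorem tangentEquiv_snd (v : TangentSpace 𝓘(ℝ, Coord m) q) :
    (hφ.tangentEquiv hq v).2 = velCoord φ q v := rfl

theorem tangentEquiv_fst (v : TangentSpace 𝓘(ℝ, Coord m) q) :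
    (hφ.tangentEquiv hq v).1 = dtForm m π q v := by
  have h1 : MDifferentiableAt 𝓘(ℝ, Coord m) 𝓘(ℝ, Coord m) φ q :=
    (contMDiffOn_of_mem_maximalAtlas hφ.1).contMDiffAt (φ.open_source.mem_nhds hq)
      |>.mdifferentiableAt (by simp)
  have h2 : MDifferentiableAt 𝓘(ℝ, Coord m) 𝓘(ℝ, ℝ) (Prod.fst : Coord m → ℝ) (φ q) :=
    mdifferentiableAt_iff_differentiableAt.mpr differentiableAt_fst
  have h4 : π =ᶠ[nhds q] (Prod.fst : Coord m → ℝ) ∘ φ := by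
    filter_upwards [φ.open_source.mem_nhds hq] with x hx using (hφ.2 x hx).symm
  have h5 := mfderiv_comp q h2 h1
  rw [← h4.mfderiv_eq, mfderiv_eq_fderiv] at h5
  have h6 := congrArg (fun f => f v) h5
  have h7 (x : Coord m) : fderiv ℝ (Prod.fst : Coord m → ℝ) (φ q) x = x.1 := by
    rw [fderiv_fst]; rfl
  exact ((h7 _).symm.trans h6.symm)

theorem tangentEquiv_eq (v : TangentSpace 𝓘(ℝ, Coord m) q) :
    hφ.tangentEquiv hq v = (dtForm m π q v, velCoord φ q v) :=
  Prod.ext (hφ.tangentEquiv_fst hq v) rfl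

theorem dtForm_tangentEquiv_symm (x : Coord m) :
    dtForm m π q ((hφ.tangentEquiv hq).symm x) = x.1 := by
  rw [← hφ.tangentEquiv_fst hq, LinearEquiv.apply_symm_apply]

theorem velCoord_tangentEquiv_symm (x : Coord m) :
    velCoord φ q ((hφ.tangentEquiv hq).symm x) = x.2 := by
  rw [← hφ.tangentEquiv_snd hq, LinearEquiv.apply_symm_apply]

theorem tangent_ext {v w : TangentSpace 𝓘(ℝ, Coord m) q}
    (h1 : dtForm m π q v = dtForm m π q w) (h2 : velCoord φ q v = velCoord φ q w) : v = w :=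
  (hφ.tangentEquiv hq).injective (by rw [hφ.tangentEquiv_eq, hφ.tangentEquiv_eq, h1, h2])

theorem jet_ext {j k : JetFibre m π q} (h : velCoord φ q j.1 = velCoord φ q k.1) : j = k :=
  Subtype.ext (hφ.tangent_ext hq (j.2.trans k.2.symm) h)

/-- The jet with given velocity coordinates. -/
noncomputable def jetOf (w : Fin m → ℝ) : JetFibre m π q :=
  ⟨(hφ.tangentEquiv hq).symm (1, w), hφ.dtForm_tangentEquiv_symm hq _⟩

theorem velCoord_jetOf (w : Fin m → ℝ) : velCoord φ q (hφ.jetOf hq w).1 = w :=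
  hφ.velCoord_tangentEquiv_symm hq _

/-- Velocity coordinates of vertical vectors. -/
noncomputable def vertEquiv : Vert m π q ≃ₗ[ℝ] (Fin m → ℝ) :=
  LinearEquiv.ofBijective (velCoord φ q ∘ₗ (Vert m π q).subtype) <| by
    constructor
    · intro u v h
      exact Subtype.ext (hφ.tangent_ext hq
        ((LinearMap.mem_ker.mp u.2).trans (LinearMap.mem_ker.mp v.2).symm) h)
    · intro w
      exact ⟨⟨(hφ.tangentEquiv hq).symm (0, w),
        LinearMap.mem_ker.mpr (hφ.dtForm_tangentEquiv_symm hq _)⟩,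
        hφ.velCoord_tangentEquiv_symm hq _⟩

theorem velCoord_vertEquiv_symm (w : Fin m → ℝ) :
    velCoord φ q ((hφ.vertEquiv hq).symm w).1 = w :=
  (hφ.vertEquiv hq).apply_symm_apply w

end IsBundleChart

theorem momOf_apply (p : Fin m → ℝ) (v : Vert m π q) :
    momOf φ q p v = p ⬝ᵥ velCoord φ q v.1 := by
  simp [momOf, dotProduct]

theorem momOf_add (p p' : Fin m → ℝ) :
    (momOf φ q (p + p') : MomFibre m π q) = momOf φ q p + momOf φ q p' := by
  ext v
  simp [momOf_apply]

theorem momOf_smul (s : ℝ) (p : Fin m → ℝ) :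
    (momOf φ q (s • p) : MomFibre m π q) = s • momOf φ q p := by
  ext v
  simp [momOf_apply]

namespace IsBundleChart

variable [IsManifold 𝓘(ℝ, Coord m) ∞ Q] (hφ : IsBundleChart m π φ) (hq : q ∈ φ.source)
include hφ hq

/-- Momentum coordinates. -/
noncomputable def momEquiv : (Fin m → ℝ) ≃ₗ[ℝ] MomFibre m π q :=
  LinearEquiv.ofBijective
    { toFun := momOf φ q, map_add' := momOf_add, map_smul' := momOf_smul } <| by
    constructor
    · intro p p' h
      refine dotProduct_eq _ _ fun w => ?_
      have := congrArg (fun z => z ((hφ.vertEquiv hq).symm w)) h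
      simpa [momOf_apply, hφ.velCoord_vertEquiv_symm hq] using this
    · intro z
      -- The momentum coordinates of `z` are its values on the coordinate basis of the vertical
      -- space.
      refine ⟨fun i => z ((hφ.vertEquiv hq).symm fun j => if i = j then 1 else 0), ?_⟩
      refine LinearMap.ext fun v => ?_
      obtain ⟨w, rfl⟩ := (hφ.vertEquiv hq).symm.surjective v
      have h := LinearMap.pi_apply_eq_sum_univ (z ∘ₗ (hφ.vertEquiv hq).symm.toLinearMap) w
      refine (momOf_apply _ _).trans ?_
      rw [hφ.velCoord_vertEquiv_symm hq]
      refine Eq.trans ?_ h.symm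
      simp [dotProduct, mul_comm]

theorem momEquiv_apply (p : Fin m → ℝ) : hφ.momEquiv hq p = momOf φ q p := rfl

theorem momOf_injective : Function.Injective (momOf φ q : _ → MomFibre m π q) :=
  (hφ.momEquiv hq).injective

theorem momOf_surjective : Function.Surjective (momOf φ q : _ → MomFibre m π q) :=
  (hφ.momEquiv hq).surjective

end IsBundleChart

/-- A vector field is smooth if and only if its components in a chart are. -/
theorem contMDiffAt_vectorField_iff [IsManifold 𝓘(ℝ, Coord m) ∞ Q]
    (hφ : φ ∈ IsManifold.maximalAtlas 𝓘(ℝ, Coord m) ∞ Q) (hq : q ∈ φ.source)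
    (X : ∀ x : Q, TangentSpace 𝓘(ℝ, Coord m) x) :
    ContMDiffAt 𝓘(ℝ, Coord m) 𝓘(ℝ, Coord m).tangent ∞
      (fun x => (⟨x, X x⟩ : TangentBundle 𝓘(ℝ, Coord m) Q)) q ↔
    ContMDiffAt 𝓘(ℝ, Coord m) 𝓘(ℝ, Coord m) ∞
      (fun x => (mfderiv 𝓘(ℝ, Coord m) 𝓘(ℝ, Coord m) φ x (X x) : Coord m)) q := by
  have h1Q : IsManifold 𝓘(ℝ, Coord m) 1 Q := IsManifold.of_le (n := ∞) (by simp)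
  have hD : φ.MDifferentiable 𝓘(ℝ, Coord m) 𝓘(ℝ, Coord m) :=
    ⟨(contMDiffOn_of_mem_maximalAtlas hφ).mdifferentiableOn (by simp),
      (contMDiffOn_symm_of_mem_maximalAtlas hφ).mdifferentiableOn (by simp)⟩
  constructor
  · intro h
    have h2 := (contMDiffOn_of_mem_maximalAtlas hφ).contMDiffOn_tangentMapWithin (m := ∞)
      (by simp) φ.open_source.uniqueMDiffOn
    have h3 := h2.contMDiffAt (x := (⟨q, X q⟩ : TangentBundle 𝓘(ℝ, Coord m) Q))
      ((φ.open_source.preimage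
        (FiberBundle.continuous_proj (Coord m) (TangentSpace 𝓘(ℝ, Coord m)))).mem_nhds hq)
    have h4 := (contMDiff_snd_tangentBundle_modelSpace (Coord m) 𝓘(ℝ, Coord m)
      (n := ∞)).contMDiffAt.comp q (h3.comp q h)
    refine h4.congr_of_eventuallyEq ?_
    filter_upwards [φ.open_source.mem_nhds hq] with x hx
    exact congrArg (fun f : TangentSpace 𝓘(ℝ, Coord m) x →L[ℝ] TangentSpace 𝓘(ℝ, Coord m) (φ x) =>
      (f (X x) : Coord m)) (mfderivWithin_of_isOpen φ.open_source hx).symm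
  · intro h
    have h2 := (contMDiffOn_symm_of_mem_maximalAtlas hφ).contMDiffOn_tangentMapWithin (m := ∞)
      (by simp) φ.open_target.uniqueMDiffOn
    let Y : Q → TangentBundle 𝓘(ℝ, Coord m) (Coord m) := fun x =>
      ⟨φ x, mfderiv 𝓘(ℝ, Coord m) 𝓘(ℝ, Coord m) φ x (X x)⟩
    have h3 := h2.contMDiffAt (x := Y q)
      ((φ.open_target.preimage
        (FiberBundle.continuous_proj (Coord m) (TangentSpace 𝓘(ℝ, Coord m)))).mem_nhds
        (φ.map_source hq))
    have hY : ContMDiffAt 𝓘(ℝ, Coord m) 𝓘(ℝ, Coord m).tangent ∞ Y q := by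
      rw [Bundle.contMDiffAt_totalSpace]
      refine ⟨(contMDiffOn_of_mem_maximalAtlas hφ).contMDiffAt (φ.open_source.mem_nhds hq), ?_⟩
      simpa [Y] using h
    refine (h3.comp q hY).congr_of_eventuallyEq ?_
    filter_upwards [φ.open_source.mem_nhds hq] with x hx
    have h5 := hD.symm_comp_deriv hx
    have h6 := congrArg (fun f => f (X x)) h5
    simp only [Function.comp_def, tangentMapWithin, Y]
    rw [mfderivWithin_of_isOpen φ.open_target (φ.map_source hx)]
    exact Bundle.TotalSpace.ext (φ.left_inv hx).symm (heq_of_eq h6.symm)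

end BundleCharts

/-! ### Smooth generalized inverses of symmetric matrices of constant rank. -/

section MatrixCalculus

variable {E : Type*} [NormedAddCommGroup E] [NormedSpace ℝ E] {ι κ : Type*} [Fintype ι] [Fintype κ]
  {s : Set E} {n : WithTop ℕ∞}

theorem ContDiffOn.matrix_det [DecidableEq ι] {A : E → Matrix ι ι ℝ}
    (hA : ∀ i j, ContDiffOn ℝ n (fun y => A y i j) s) : ContDiffOn ℝ n (fun y => (A y).det) s := by
  simp only [Matrix.det_apply]
  exact ContDiffOn.sum fun σ _ => (contDiffOn_prod fun i _ => hA _ _).const_smul _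

theorem ContDiffOn.matrix_inv [DecidableEq ι] {A : E → Matrix ι ι ℝ}
    (hA : ∀ i j, ContDiffOn ℝ n (fun y => A y i j) s) (h0 : ∀ y ∈ s, (A y).det ≠ 0) (i j : ι) :
    ContDiffOn ℝ n (fun y => (A y)⁻¹ i j) s := by
  -- Cramer's rule: each entry is a determinant with one row replaced by a constant, divided by `det
  -- A`.
  simp only [Matrix.inv_def, Ring.inverse_eq_inv', Matrix.smul_apply, Matrix.adjugate_apply,
    smul_eq_mul]
  refine ((ContDiffOn.matrix_det hA).inv h0).mul (ContDiffOn.matrix_det fun k l => ?_)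
  by_cases hk : k = j
  · subst hk
    simpa using contDiffOn_const
  · simpa [Matrix.updateRow_ne hk] using hA k l

theorem ContDiffOn.matrix_mul {ι' κ' : Type*} {A : E → Matrix ι' ι ℝ} {B : E → Matrix ι κ' ℝ}
    (hA : ∀ i j, ContDiffOn ℝ n (fun y => A y i j) s)
    (hB : ∀ i j, ContDiffOn ℝ n (fun y => B y i j) s) (i : ι') (j : κ') :
    ContDiffOn ℝ n (fun y => (A y * B y) i j) s := by
  simp only [Matrix.mul_apply]
  exact ContDiffOn.sum fun k _ => (hA i k).mul (hB k j)

/-- A symmetric matrix is nondegenerate on a complement of its kernel. -/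
theorem Matrix.IsSymm.exists_det_ne_zero {A : Matrix ι ι ℝ} (hA : A.IsSymm) {k : ℕ}
    (hk : A.rank = k) : ∃ U : Matrix ι (Fin k) ℝ, (Uᵀ * A * U).det ≠ 0 := by
  obtain ⟨W, hW⟩ := Submodule.exists_isCompl (LinearMap.ker A.mulVecLin)
  have hr : Module.finrank ℝ W = k := by
    have h1 := Submodule.finrank_add_eq_of_isCompl hW
    have h2 := LinearMap.finrank_range_add_finrank_ker A.mulVecLin
    have h3 : A.rank = Module.finrank ℝ (LinearMap.range A.mulVecLin) := rfl
    omega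
  let B := Module.finBasisOfFinrankEq ℝ W hr
  -- The columns of `U` are a basis of a complement `W` of the kernel, so `Uᵀ A U` is the Gram
  -- matrix of the form on `W`.
  let U : Matrix ι (Fin k) ℝ := Matrix.of fun i k => (B k : ι → ℝ) i
  have hU (x : Fin k → ℝ) : U *ᵥ x = ((B.equivFun.symm x : W) : ι → ℝ) := by
    ext i
    simp [U, Matrix.mulVec, dotProduct, B.equivFun_symm_apply, mul_comm]
  refine ⟨U, fun h0 => ?_⟩
  obtain ⟨x, hx0, hx⟩ := Matrix.exists_mulVec_eq_zero_iff.mpr h0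
  set w : W := B.equivFun.symm x with hw
  -- A null vector of the Gram matrix gives `w` orthogonal to `W`. It is orthogonal to `ker A` by
  -- symmetry, hence `A w = 0` and `w ∈ ker A ∩ W = 0`. No definiteness is needed.
  have hWA (w' : W) : (w' : ι → ℝ) ⬝ᵥ A *ᵥ (w : ι → ℝ) = 0 := by
    have h2 := hU (B.equivFun w')
    rw [LinearEquiv.symm_apply_apply] at h2
    rw [← h2, hw, ← hU, Matrix.mulVec_mulVec, dotProduct_comm, Matrix.dotProduct_mulVec,
      ← Matrix.mulVec_transpose, Matrix.mulVec_mulVec, ← Matrix.mul_assoc, hx, zero_dotProduct]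
  have hA0 : A *ᵥ (w : ι → ℝ) = 0 := by
    refine dotProduct_eq_zero _ fun v => ?_
    have hv : v ∈ LinearMap.ker A.mulVecLin ⊔ W := hW.sup_eq_top ▸ Submodule.mem_top
    obtain ⟨u, hu, w', hw', rfl⟩ := Submodule.mem_sup.mp hv
    have hu' : A *ᵥ u = 0 := hu
    rw [dotProduct_comm, add_dotProduct, hWA ⟨w', hw'⟩, add_zero, Matrix.dotProduct_mulVec,
      ← Matrix.mulVec_transpose, hA.eq, hu', zero_dotProduct]
  have hw0 : (w : ι → ℝ) = 0 := by
    have h3 : (w : ι → ℝ) ∈ LinearMap.ker A.mulVecLin ⊓ W := ⟨hA0, w.2⟩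
    simpa [hW.inf_eq_bot] using h3
  exact hx0 (B.equivFun.symm.map_eq_zero_iff.mp (Subtype.ext hw0))

/-- The equation is immediate after replacing the last factor `A` by `A U`. This suffices because `k
= rank (Uᵀ A U) ≤ rank (A U) ≤ rank A = k` forces `A U` and `A` to have the same range. -/
theorem Matrix.generalized_inverse_of_det_ne_zero {A : Matrix ι ι ℝ} {k : ℕ} (hk : A.rank = k)
    {U : Matrix ι (Fin k) ℝ} (hU : (Uᵀ * A * U).det ≠ 0) :
    A * (U * (Uᵀ * A * U)⁻¹ * Uᵀ) * A = A := by
  classical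
  have hGu : IsUnit (Uᵀ * A * U).det := isUnit_iff_ne_zero.mpr hU
  have h1 : (Uᵀ * A * U).rank = k := by
    rw [Matrix.rank_of_isUnit _ ((Matrix.isUnit_iff_isUnit_det _).mpr hGu), Fintype.card_fin]
  have h2 : (Uᵀ * A * U).rank ≤ (A * U).rank := by
    rw [Matrix.mul_assoc]
    exact Matrix.rank_mul_le_right _ _
  have h3 : (A * U).rank ≤ A.rank := Matrix.rank_mul_le_left _ _
  have h4 : LinearMap.range (A * U).mulVecLin = LinearMap.range A.mulVecLin := by
    refine Submodule.eq_of_le_of_finrank_eq ?_ ?_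
    · rw [Matrix.mulVecLin_mul]
      exact LinearMap.range_comp_le_range _ _
    · exact le_antisymm h3 ((hk.trans h1.symm).trans_le h2)
  have h5 : A * (U * (Uᵀ * A * U)⁻¹ * Uᵀ) * (A * U) = A * U := by
    calc _ = A * U * ((Uᵀ * A * U)⁻¹ * (Uᵀ * A * U)) := by simp only [Matrix.mul_assoc]
      _ = _ := by rw [Matrix.nonsing_inv_mul _ hGu, Matrix.mul_one]
  refine Matrix.ext_of_mulVec_single fun i => ?_
  have h6 : A *ᵥ Pi.single i 1 ∈ LinearMap.range (A * U).mulVecLin :=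
    h4 ▸ ⟨Pi.single i 1, rfl⟩
  obtain ⟨x, hx⟩ := h6
  rw [Matrix.mulVecLin_apply] at hx
  rw [← Matrix.mulVec_mulVec, ← hx, Matrix.mulVec_mulVec, h5]

/-- Near a point, a smooth symmetric matrix function of constant rank has a smooth symmetric
generalized inverse. -/
theorem exists_local_symm_generalized_inverse {A : E → Matrix ι ι ℝ} (hs : IsOpen s)
    (hA : ∀ i j, ContDiffOn ℝ n (fun y => A y i j) s) (hsymm : ∀ y ∈ s, (A y).IsSymm)
    {k : ℕ} (hk : ∀ y ∈ s, (A y).rank = k) {y₀ : E} (hy₀ : y₀ ∈ s) :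
    ∃ (t : Set E) (S : E → Matrix ι ι ℝ), IsOpen t ∧ y₀ ∈ t ∧ t ⊆ s ∧
      (∀ i j, ContDiffOn ℝ n (fun y => S y i j) t) ∧
      ∀ y ∈ t, (S y).IsSymm ∧ A y * S y * A y = A y := by
  obtain ⟨U, hU⟩ := (hsymm y₀ hy₀).exists_det_ne_zero (hk y₀ hy₀)
  let G : E → Matrix (Fin k) (Fin k) ℝ := fun y => Uᵀ * A y * U
  have hG (i j) : ContDiffOn ℝ n (fun y => G y i j) s :=
    ContDiffOn.matrix_mul (A := fun y => Uᵀ * A y) (B := fun _ => U)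
      (ContDiffOn.matrix_mul (A := fun _ => Uᵀ) (fun _ _ => contDiffOn_const) hA)
      (fun _ _ => contDiffOn_const) i j
  have hGsymm (y) (hy : y ∈ s) : (G y)ᵀ = G y := by
    simp [G, Matrix.transpose_mul, (hsymm y hy).eq, Matrix.mul_assoc]
  -- The matrix `U` found at `y₀` is kept fixed; it still works wherever the Gram determinant is
  -- nonzero, an open condition, because the rank stays equal to `k`.
  let t : Set E := s ∩ (fun y => (G y).det) ⁻¹' {0}ᶜ
  have ht : IsOpen t := (ContDiffOn.matrix_det (A := G) hG).continuousOn.isOpen_inter_preimage hs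
    isOpen_compl_singleton
  have hts : t ⊆ s := Set.inter_subset_left
  have hGi (i j) : ContDiffOn ℝ n (fun y => (G y)⁻¹ i j) t :=
    ContDiffOn.matrix_inv (A := G) (fun i j => (hG i j).mono hts) (fun y hy => hy.2) i j
  have hS (i j) : ContDiffOn ℝ n (fun y => (U * (G y)⁻¹ * Uᵀ) i j) t :=
    ContDiffOn.matrix_mul (A := fun y => U * (G y)⁻¹) (B := fun _ => Uᵀ)
      (ContDiffOn.matrix_mul (A := fun _ => U) (fun _ _ => contDiffOn_const) hGi)
      (fun _ _ => contDiffOn_const) i j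
  refine ⟨t, fun y => U * (G y)⁻¹ * Uᵀ, ht, ⟨hy₀, hU⟩, hts,
    hS, fun y hy => ⟨?_, ?_⟩⟩
  · simp [Matrix.IsSymm, Matrix.transpose_mul, Matrix.transpose_nonsing_inv, hGsymm y hy.1,
      Matrix.mul_assoc]
  · exact Matrix.generalized_inverse_of_det_ne_zero (hk y hy.1) hy.2

end MatrixCalculus

/-! ### The Legendre map and the Hamiltonian in coordinates. -/

section LegendreMap

theorem hasDerivAt_quadratic {ι : Type*} [Fintype ι] {A : Matrix ι ι ℝ} (hA : A.IsSymm)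
    (b x u : ι → ℝ) (c : ℝ) :
    HasDerivAt (fun s : ℝ => 1 / 2 * ((x + s • u) ⬝ᵥ A *ᵥ (x + s • u)) + b ⬝ᵥ (x + s • u) + c)
      ((A *ᵥ x + b) ⬝ᵥ u) 0 := by
  have hsymm : u ⬝ᵥ A *ᵥ x = x ⬝ᵥ A *ᵥ u := by
    rw [Matrix.dotProduct_mulVec, ← Matrix.mulVec_transpose, hA.eq, dotProduct_comm]
  have h1 : (fun s : ℝ => 1 / 2 * ((x + s • u) ⬝ᵥ A *ᵥ (x + s • u)) + b ⬝ᵥ (x + s • u) + c) =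
      fun s : ℝ => (1 / 2 * (x ⬝ᵥ A *ᵥ x) + b ⬝ᵥ x + c) + ((A *ᵥ x + b) ⬝ᵥ u) * s +
        1 / 2 * (u ⬝ᵥ A *ᵥ u) * s ^ 2 := by
    funext s
    simp only [Matrix.mulVec_add, Matrix.mulVec_smul, dotProduct_add, add_dotProduct,
      smul_dotProduct, dotProduct_smul, smul_eq_mul, hsymm, dotProduct_comm (A *ᵥ x) u]
    ring
  rw [h1]
  have h2 := (((hasDerivAt_id (0 : ℝ)).const_mul ((A *ᵥ x + b) ⬝ᵥ u)).const_add
    (1 / 2 * (x ⬝ᵥ A *ᵥ x) + b ⬝ᵥ x + c)).add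
    (((hasDerivAt_id (0 : ℝ)).pow 2).const_mul (1 / 2 * (u ⬝ᵥ A *ᵥ u)))
  simpa using! h2

variable {m : ℕ} {Q : Type*} [TopologicalSpace Q] [ChartedSpace (Coord m) Q] {π : Q → ℝ}
  {φ : OpenPartialHomeomorph Q (Coord m)} {q : Q}

/-- The coordinate expression of a quadratic Lagrangian in a given chart. -/
structure IsQuadraticIn (L : Lagrangian m π) (a : ∀ q : Q, Vert m π q →ₗ[ℝ] MomFibre m π q)
    (φ : OpenPartialHomeomorph Q (Coord m)) (A : Coord m → Matrix (Fin m) (Fin m) ℝ)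
    (b : Coord m → Fin m → ℝ) (c : Coord m → ℝ) : Prop where
  contDiffOn_A : ∀ i j, ContDiffOn ℝ ∞ (fun y => A y i j) φ.target
  contDiffOn_b : ContDiffOn ℝ ∞ b φ.target
  contDiffOn_c : ContDiffOn ℝ ∞ c φ.target
  isSymm : ∀ y ∈ φ.target, (A y).IsSymm
  form_apply : ∀ q ∈ φ.source, ∀ u v : Vert m π q,
    a q u v = velCoord φ q u ⬝ᵥ A (φ q) *ᵥ velCoord φ q v
  lagrangian_apply : ∀ q ∈ φ.source, ∀ j : JetFibre m π q,
    L q j = 1 / 2 * (velCoord φ q j.1 ⬝ᵥ A (φ q) *ᵥ velCoord φ q j.1) +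
      b (φ q) ⬝ᵥ velCoord φ q j.1 + c (φ q)

theorem IsQuadratic.exists_isQuadraticIn {L : Lagrangian m π}
    {a : ∀ q : Q, Vert m π q →ₗ[ℝ] MomFibre m π q} (hL : IsQuadratic L a)
    (hφ : IsBundleChart m π φ) : ∃ A b c, IsQuadraticIn L a φ A b c := by
  obtain ⟨A, b, c, h1, h2, h3, h4, h5, h6⟩ := hL φ hφ
  exact ⟨A, b, c, h1, h2, h3, h4, h5, h6⟩

theorem JetFibre.velCoord_add (j : JetFibre m π q) (v : Vert m π q) :
    velCoord φ q (j.add v).1 = velCoord φ q j.1 + velCoord φ q v.1 :=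
  map_add _ _ _

theorem JetFibre.exists_eq_add (j k : JetFibre m π q) : ∃ v : Vert m π q, j = k.add v :=
  ⟨⟨j.1 - k.1, LinearMap.mem_ker.mpr (by rw [map_sub, j.2, k.2, sub_self])⟩,
    Subtype.ext (add_sub_cancel k.1 j.1).symm⟩

namespace IsQuadraticIn

variable {L : Lagrangian m π} {a : ∀ q : Q, Vert m π q →ₗ[ℝ] MomFibre m π q}
  {A : Coord m → Matrix (Fin m) (Fin m) ℝ} {b : Coord m → Fin m → ℝ} {c : Coord m → ℝ}
  (h : IsQuadraticIn L a φ A b c) (hq : q ∈ φ.source)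
include h hq

theorem legendre_eq (j : JetFibre m π q) :
    legendre L q j = momOf φ q (A (φ q) *ᵥ velCoord φ q j.1 + b (φ q)) := by
  have hs := h.isSymm _ (φ.map_source hq)
  have key : ∀ v : Vert m π q, HasDerivAt (fun s : ℝ => L q (j.add (s • v)))
      (momOf φ q (A (φ q) *ᵥ velCoord φ q j.1 + b (φ q)) v) 0 := by
    intro v
    rw [momOf_apply]
    refine (hasDerivAt_quadratic hs (b (φ q)) (velCoord φ q j.1) (velCoord φ q v.1)
      (c (φ q))).congr_of_eventuallyEq (Filter.Eventually.of_forall fun s => ?_)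
    have h1 : velCoord φ q (j.add (s • v)).1 = velCoord φ q j.1 + s • velCoord φ q v.1 := by
      rw [JetFibre.velCoord_add]
      exact congrArg _ (map_smul _ _ _)
    beta_reduce
    rw [h.lagrangian_apply q hq, h1]
  have hex : ∃ p : MomFibre m π q, ∀ v : Vert m π q,
      HasDerivAt (fun s : ℝ => L q (j.add (s • v))) (p v) 0 := ⟨_, key⟩
  rw [legendre, dif_pos hex]
  -- Uniqueness of derivatives identifies the chosen momentum, so the default value `0` never
  -- occurs.
  exact LinearMap.ext fun v => (hex.choose_spec v).unique (key v)

theorem form_eq (v : Vert m π q) : a q v = momOf φ q (A (φ q) *ᵥ velCoord φ q v.1) := by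
  refine LinearMap.ext fun u => ?_
  rw [h.form_apply q hq, momOf_apply, Matrix.dotProduct_mulVec, ← Matrix.mulVec_transpose,
    (h.isSymm _ (φ.map_source hq)).eq]

end IsQuadraticIn

namespace IsBundleChart

variable [IsManifold 𝓘(ℝ, Coord m) ∞ Q] (hφ : IsBundleChart m π φ) {y : Coord m}
  (hy : y ∈ φ.target)
include hφ hy

theorem velCoord_coordVec (x : Coord m) : velCoord φ (φ.symm y) (coordVec φ y x) = x.2 := by
  have h := congrArg (fun f : TangentSpace 𝓘(ℝ, Coord m) y →L[ℝ] TangentSpace 𝓘(ℝ, Coord m) y =>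
    (f x : Coord m)) (hφ.mdifferentiable.comp_symm_deriv hy)
  exact congrArg Prod.snd h

theorem coordLagrangian_velCoord (L : Lagrangian m π) (j : JetFibre m π (φ.symm y)) :
    coordLagrangian L φ y (velCoord φ (φ.symm y) j.1) = L (φ.symm y) j := by
  have h : dtForm m π (φ.symm y) (coordVec φ y (1, velCoord φ (φ.symm y) j.1)) = 1 :=
    dtForm_coordVec hφ hy _
  rw [coordLagrangian, dif_pos h]
  congr 1
  exact hφ.jet_ext (φ.map_target hy) (hφ.velCoord_coordVec hy _)

/-- The vertical projection defined by a jet `j` sends `∂_t` to `∂_t - j`, whose velocity components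
are `-j^i`; this produces the Legendre-type expression `p · Φ - 𝓛(Φ)`. -/
theorem coordHamiltonian_formOfMap (L : Lagrangian m π)
    (Φ : ∀ q : Q, MomFibre m π q → JetFibre m π q) (p : Fin m → ℝ) :
    coordHamiltonian (formOfMap L Φ) φ y p =
      p ⬝ᵥ velCoord φ (φ.symm y) (Φ (φ.symm y) (momOf φ (φ.symm y) p)).1 -
      coordLagrangian L φ y
        (velCoord φ (φ.symm y) (Φ (φ.symm y) (momOf φ (φ.symm y) p)).1) := by
  rw [hφ.coordLagrangian_velCoord hy]
  set j := Φ (φ.symm y) (momOf φ (φ.symm y) p) with hj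
  have h1 : dtForm m π (φ.symm y) (coordVec φ y (1, 0)) = 1 := dtForm_coordVec hφ hy _
  have h2 : velCoord φ (φ.symm y) (vertProj j (coordVec φ y (1, 0))).1 =
      -velCoord φ (φ.symm y) j.1 := by
    have h3 : (vertProj j (coordVec φ y (1, 0))).1 = coordVec φ y (1, 0) - j.1 := by
      change coordVec φ y (1, 0) - dtForm m π (φ.symm y) (coordVec φ y (1, 0)) • j.1 = _
      rw [h1, one_smul]
    rw [h3, map_sub, hφ.velCoord_coordVec hy]
    simp
  have h4 : formOfMap L Φ (φ.symm y) (momOf φ (φ.symm y) p) (coordVec φ y (1, 0)) =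
      momOf φ (φ.symm y) p (vertProj j (coordVec φ y (1, 0))) +
        L (φ.symm y) j * dtForm m π (φ.symm y) (coordVec φ y (1, 0)) := rfl
  rw [coordHamiltonian, h4, h1, momOf_apply, h2, dotProduct_neg]
  ring

end IsBundleChart

theorem IsQuadraticIn.coordLagrangian_eq [IsManifold 𝓘(ℝ, Coord m) ∞ Q] {L : Lagrangian m π}
    {a : ∀ q : Q, Vert m π q →ₗ[ℝ] MomFibre m π q} {A : Coord m → Matrix (Fin m) (Fin m) ℝ}
    {b : Coord m → Fin m → ℝ} {c : Coord m → ℝ} (h : IsQuadraticIn L a φ A b c)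
    (hφ : IsBundleChart m π φ) {y : Coord m} (hy : y ∈ φ.target) (w : Fin m → ℝ) :
    coordLagrangian L φ y w = 1 / 2 * (w ⬝ᵥ A y *ᵥ w) + b y ⬝ᵥ w + c y := by
  have h1 := hφ.coordLagrangian_velCoord hy L (hφ.jetOf (φ.map_target hy) w)
  rwa [hφ.velCoord_jetOf, h.lagrangian_apply _ (φ.map_target hy), hφ.velCoord_jetOf,
    φ.right_inv hy] at h1

section Intrinsic

variable {L : Lagrangian m π}
  {a : ∀ q : Q, Vert m π q →ₗ[ℝ] MomFibre m π q} (hL : IsQuadratic L a)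
  (hφ : IsBundleChart m π φ) (hq : q ∈ φ.source)
include hL hφ hq

/-- The chart-free form of `p_i = a_ij q^j_t + b_i`: the inhomogeneous term `b` cancels in
differences. -/
theorem IsQuadratic.legendre_add (j : JetFibre m π q) (v : Vert m π q) :
    legendre L q (j.add v) = legendre L q j + a q v := by
  obtain ⟨A, b, c, h⟩ := hL.exists_isQuadraticIn hφ
  rw [h.legendre_eq hq, h.legendre_eq hq, h.form_eq hq, ← momOf_add, JetFibre.velCoord_add,
    Matrix.mulVec_add]
  congr 1
  abel

/-- An affine image that contains the origin is the image of its linear part. -/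
theorem IsQuadratic.mem_constraintSpace_iff (hzero : (0 : MomFibre m π q) ∈ constraintSpace L q)
    (z : MomFibre m π q) : z ∈ constraintSpace L q ↔ ∃ v, a q v = z := by
  obtain ⟨j₀, hj₀⟩ := hzero
  constructor
  · rintro ⟨j, rfl⟩
    obtain ⟨v, rfl⟩ := j.exists_eq_add j₀
    exact ⟨v, by rw [hL.legendre_add hφ hq, hj₀, zero_add]⟩
  · rintro ⟨v, rfl⟩
    exact ⟨j₀.add v, by rw [hL.legendre_add hφ hq, hj₀, zero_add]⟩

end Intrinsic

end LegendreMap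

/-! ### Smooth bundle maps `V*Q → VQ` and the global generalized inverse. -/

section BundleMaps

variable {m : ℕ} {Q : Type*} [TopologicalSpace Q] [ChartedSpace (Coord m) Q] {π : Q → ℝ}
  {φ ψ : OpenPartialHomeomorph Q (Coord m)} {q : Q}

/-- The matrix `σ^{ij}` of a linear map `σ : V*_q Q → V_q Q` in a bundle chart. -/
noncomputable def bundleMatrix (φ : OpenPartialHomeomorph Q (Coord m))
    (σ : ∀ q : Q, MomFibre m π q →ₗ[ℝ] Vert m π q) (q : Q) : Matrix (Fin m) (Fin m) ℝ :=
  LinearMap.toMatrix' (velCoord φ q ∘ₗ (Vert m π q).subtype ∘ₗ σ q ∘ₗ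
    { toFun := momOf φ q, map_add' := momOf_add, map_smul' := momOf_smul })

theorem bundleMatrix_mulVec (σ : ∀ q : Q, MomFibre m π q →ₗ[ℝ] Vert m π q) (p : Fin m → ℝ) :
    bundleMatrix φ σ q *ᵥ p = velCoord φ q (σ q (momOf φ q p)).1 :=
  LinearMap.toMatrix'_mulVec _ _

theorem bundleMatrix_apply (σ : ∀ q : Q, MomFibre m π q →ₗ[ℝ] Vert m π q) (i j : Fin m) :
    bundleMatrix φ σ q i j = velCoord φ q (σ q (momOf φ q (Pi.single j 1))).1 i := by
  rw [← bundleMatrix_mulVec]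
  simp

namespace IsBundleChart

variable [IsManifold 𝓘(ℝ, Coord m) ∞ Q] (hφ : IsBundleChart m π φ)

open Classical in
/-- The vertical vector field with constant components `w` in a bundle chart, extended by zero. -/
noncomputable def constVert (w : Fin m → ℝ) (q : Q) : Vert m π q :=
  if hq : q ∈ φ.source then (hφ.vertEquiv hq).symm w else 0

theorem constVert_of_mem (hq : q ∈ φ.source) (w : Fin m → ℝ) :
    hφ.constVert w q = (hφ.vertEquiv hq).symm w := dif_pos hq

/-- Smoothness of a vector field does not depend on the chart, so constant components in `φ` become
smooth components in `ψ`. This makes the Jacobian smooth without differentiating transition maps. -/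
theorem contMDiffAt_velCoord_constVert (hψ : IsBundleChart m π ψ) (hqφ : q ∈ φ.source)
    (hqψ : q ∈ ψ.source) (w : Fin m → ℝ) :
    ContMDiffAt 𝓘(ℝ, Coord m) 𝓘(ℝ, Fin m → ℝ) ∞
      (fun x => velCoord ψ x (hφ.constVert w x).1) q := by
  have h1 : ContMDiffAt 𝓘(ℝ, Coord m) 𝓘(ℝ, Coord m).tangent ∞
      (fun x => (⟨x, (hφ.constVert w x).1⟩ : TangentBundle 𝓘(ℝ, Coord m) Q)) q := by
    rw [contMDiffAt_vectorField_iff hφ.1 hqφ]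
    refine (contMDiffAt_const (c := ((0, w) : Coord m))).congr_of_eventuallyEq ?_
    filter_upwards [φ.open_source.mem_nhds hqφ] with x hx
    rw [hφ.constVert_of_mem hx]
    exact (hφ.tangentEquiv_eq hx _).trans (Prod.ext
      (LinearMap.mem_ker.mp ((hφ.vertEquiv hx).symm w).2) (hφ.velCoord_vertEquiv_symm hx w))
  rw [contMDiffAt_vectorField_iff hψ.1 hqψ] at h1
  exact contDiff_snd.contMDiff.contMDiffAt.comp q h1

/-- The Jacobian matrix `∂ψ^i/∂q^j` of the change of bundle coordinates. -/
noncomputable def jacobian (ψ : OpenPartialHomeomorph Q (Coord m)) (q : Q) :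
    Matrix (Fin m) (Fin m) ℝ :=
  Matrix.of fun i j => velCoord ψ q (hφ.constVert (Pi.single j 1) q).1 i

theorem jacobian_mulVec (hq : q ∈ φ.source) (v : Vert m π q) :
    hφ.jacobian ψ q *ᵥ velCoord φ q v.1 = velCoord ψ q v.1 := by
  obtain ⟨w, rfl⟩ := (hφ.vertEquiv hq).symm.surjective v
  rw [hφ.velCoord_vertEquiv_symm hq]
  have h : hφ.jacobian ψ q = LinearMap.toMatrix'
      (velCoord ψ q ∘ₗ (Vert m π q).subtype ∘ₗ (hφ.vertEquiv hq).symm.toLinearMap) := by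
    ext i j
    rw [LinearMap.toMatrix'_apply]
    simp [jacobian, hφ.constVert_of_mem hq]
  rw [h]
  exact LinearMap.toMatrix'_mulVec _ _

theorem momOf_jacobian (hq : q ∈ φ.source) (p : Fin m → ℝ) :
    (momOf ψ q p : MomFibre m π q) = momOf φ q ((hφ.jacobian ψ q)ᵀ *ᵥ p) := by
  refine LinearMap.ext fun v => ?_
  rw [momOf_apply, momOf_apply, ← hφ.jacobian_mulVec hq, Matrix.mulVec_transpose,
    Matrix.dotProduct_mulVec]

/-- The transformation law of a contravariant 2-tensor: one Jacobian comes from the velocities, its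
transpose from the momenta. -/
theorem bundleMatrix_eq (hq : q ∈ φ.source) (σ : ∀ q : Q, MomFibre m π q →ₗ[ℝ] Vert m π q) :
    bundleMatrix ψ σ q = hφ.jacobian ψ q * bundleMatrix φ σ q * (hφ.jacobian ψ q)ᵀ := by
  refine Matrix.ext_of_mulVec_single fun i => ?_
  rw [bundleMatrix_mulVec, ← Matrix.mulVec_mulVec, ← Matrix.mulVec_mulVec, bundleMatrix_mulVec,
    hφ.jacobian_mulVec hq, ← hφ.momOf_jacobian hq]

include hφ in
theorem contMDiffAt_bundleMatrix (hψ : IsBundleChart m π ψ) (hqφ : q ∈ φ.source)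
    (hqψ : q ∈ ψ.source) {σ : ∀ q : Q, MomFibre m π q →ₗ[ℝ] Vert m π q}
    (h : ∀ i j, ContMDiffAt 𝓘(ℝ, Coord m) 𝓘(ℝ, ℝ) ∞ (fun x => bundleMatrix φ σ x i j) q)
    (i j : Fin m) :
    ContMDiffAt 𝓘(ℝ, Coord m) 𝓘(ℝ, ℝ) ∞ (fun x => bundleMatrix ψ σ x i j) q := by
  have hJ (i j) : ContMDiffAt 𝓘(ℝ, Coord m) 𝓘(ℝ, ℝ) ∞ (fun x => hφ.jacobian ψ x i j) q :=
    contMDiffAt_pi_space.mp (hφ.contMDiffAt_velCoord_constVert hψ hqφ hqψ (Pi.single j 1)) i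
  have h1 : ContMDiffAt 𝓘(ℝ, Coord m) 𝓘(ℝ, ℝ) ∞ (fun x => ∑ k, (∑ l, hφ.jacobian ψ x i l *
      bundleMatrix φ σ x l k) * hφ.jacobian ψ x j k) q :=
    contMDiffAt_finsetSum fun k _ => (contMDiffAt_finsetSum fun l _ =>
      (hJ i l).mul (h l k)).mul (hJ j k)
  refine h1.congr_of_eventuallyEq ?_
  filter_upwards [φ.open_source.mem_nhds hqφ] with x hx
  rw [hφ.bundleMatrix_eq hx]
  simp [Matrix.mul_apply]

/-- Smoothness of a bundle map can be checked in one bundle chart around each point. -/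
theorem _root_.isSmoothBundleMap_of_contMDiffAt
    {σ : ∀ q : Q, MomFibre m π q →ₗ[ℝ] Vert m π q}
    (h : ∀ q : Q, ∃ φ : OpenPartialHomeomorph Q (Coord m), IsBundleChart m π φ ∧ q ∈ φ.source ∧
      ∀ i j, ContMDiffAt 𝓘(ℝ, Coord m) 𝓘(ℝ, ℝ) ∞ (fun x => bundleMatrix φ σ x i j) q) :
    IsSmoothBundleMap σ := by
  intro ψ hψ
  refine ⟨fun y => bundleMatrix ψ σ (ψ.symm y), fun i j => ?_, fun q hq p => ?_⟩
  · rw [← contMDiffOn_iff_contDiffOn]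
    have h1 : ContMDiffOn 𝓘(ℝ, Coord m) 𝓘(ℝ, ℝ) ∞ (fun x => bundleMatrix ψ σ x i j)
        ψ.source := by
      intro q hq
      obtain ⟨φ, hφ, hqφ, hs⟩ := h q
      exact (hφ.contMDiffAt_bundleMatrix hψ hqφ hq hs i j).contMDiffWithinAt
    exact h1.comp (contMDiffOn_symm_of_mem_maximalAtlas hψ.1) fun y hy => ψ.map_target hy
  · beta_reduce
    rw [ψ.left_inv hq, bundleMatrix_mulVec]

open Classical in
/-- The local bundle map `V*Q → VQ` with given matrix in a bundle chart, extended by zero. -/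
noncomputable def bundleMapOf (S : Coord m → Matrix (Fin m) (Fin m) ℝ) (q : Q) :
    MomFibre m π q →ₗ[ℝ] Vert m π q :=
  if hq : q ∈ φ.source then (hφ.vertEquiv hq).symm.toLinearMap ∘ₗ (S (φ q)).mulVecLin ∘ₗ
    (hφ.momEquiv hq).symm.toLinearMap else 0

theorem bundleMapOf_momOf (S : Coord m → Matrix (Fin m) (Fin m) ℝ) (hq : q ∈ φ.source)
    (p : Fin m → ℝ) :
    hφ.bundleMapOf S q (momOf φ q p) = (hφ.vertEquiv hq).symm (S (φ q) *ᵥ p) := by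
  rw [bundleMapOf, dif_pos hq, ← hφ.momEquiv_apply hq]
  simp

theorem velCoord_bundleMapOf (S : Coord m → Matrix (Fin m) (Fin m) ℝ) (hq : q ∈ φ.source)
    (p : Fin m → ℝ) :
    velCoord φ q (hφ.bundleMapOf S q (momOf φ q p)).1 = S (φ q) *ᵥ p := by
  rw [hφ.bundleMapOf_momOf S hq, hφ.velCoord_vertEquiv_symm hq]

theorem contMDiffAt_bundleMatrix_bundleMapOf {S : Coord m → Matrix (Fin m) (Fin m) ℝ}
    (hq : q ∈ φ.source) (hS : ∀ i j, ContDiffAt ℝ ∞ (fun y => S y i j) (φ q)) (i j : Fin m) :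
    ContMDiffAt 𝓘(ℝ, Coord m) 𝓘(ℝ, ℝ) ∞
      (fun x => bundleMatrix φ (hφ.bundleMapOf S) x i j) q := by
  refine ((hS i j).contMDiffAt.comp q
    (contMDiffAt_of_mem_maximalAtlas hφ.1 hq)).congr_of_eventuallyEq ?_
  filter_upwards [φ.open_source.mem_nhds hq] with x hx
  rw [bundleMatrix_apply, hφ.velCoord_bundleMapOf S hx]
  simp

/-- Carries the intrinsic constant rank hypothesis over to the coordinate matrices. -/
theorem _root_.IsQuadraticIn.rank_eq {L : Lagrangian m π}
    {a : ∀ q : Q, Vert m π q →ₗ[ℝ] MomFibre m π q} {A : Coord m → Matrix (Fin m) (Fin m) ℝ}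
    {b : Coord m → Fin m → ℝ} {c : Coord m → ℝ} (h : IsQuadraticIn L a φ A b c)
    (hφ : IsBundleChart m π φ) (hq : q ∈ φ.source) :
    (A (φ q)).rank = Module.finrank ℝ (LinearMap.range (a q)) := by
  have h1 : a q = (hφ.momEquiv hq).toLinearMap ∘ₗ (A (φ q)).mulVecLin ∘ₗ
      (hφ.vertEquiv hq).toLinearMap :=
    LinearMap.ext fun v => h.form_eq hq v
  rw [h1, LinearMap.range_comp, LinearEquiv.range_comp]
  exact (LinearEquiv.finrank_map_eq _ _).symm

end IsBundleChart

variable [IsManifold 𝓘(ℝ, Coord m) ∞ Q]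

/-- The symmetric generalized inverses of a linear map `V_q Q → V*_q Q`. -/
def symmGeneralizedInverses {q : Q} (a : Vert m π q →ₗ[ℝ] MomFibre m π q) :
    Set (MomFibre m π q →ₗ[ℝ] Vert m π q) :=
  {σ | (∀ v, a (σ (a v)) = a v) ∧ ∀ z z' : MomFibre m π q, z' (σ z) = z (σ z')}

omit [IsManifold 𝓘(ℝ, Coord m) ∞ Q] in
-- `σ` occurs only once in `a σ a = a`, so the equation is affine and survives combinations with
-- weights of sum one. The reflexive equation `σ a σ = σ` is quadratic and would not; it is not
-- imposed.
theorem convex_symmGeneralizedInverses {q : Q} (a : Vert m π q →ₗ[ℝ] MomFibre m π q) :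
    Convex ℝ (symmGeneralizedInverses a) := by
  rintro σ ⟨h1, h2⟩ τ ⟨h3, h4⟩ α β - - hαβ
  refine ⟨fun v => ?_, fun z z' => ?_⟩
  · simp only [LinearMap.add_apply, LinearMap.smul_apply, map_add, map_smul, h1, h3]
    rw [← add_smul, hαβ, one_smul]
  · simp only [LinearMap.add_apply, LinearMap.smul_apply, map_add, map_smul, h2 z, h4 z]

theorem IsQuadratic.exists_local_symmGeneralizedInverse
    {L : Lagrangian m π} {a : ∀ q : Q, Vert m π q →ₗ[ℝ] MomFibre m π q} (hL : IsQuadratic L a)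
    {k : ℕ} (hk : ∀ q : Q, Module.finrank ℝ (LinearMap.range (a q)) = k)
    (hφ : IsBundleChart m π φ) (hq : q ∈ φ.source) :
    ∃ (U : Set Q) (σ : ∀ q : Q, MomFibre m π q →ₗ[ℝ] Vert m π q), IsOpen U ∧ q ∈ U ∧
      U ⊆ φ.source ∧
      (∀ x ∈ U, ∀ i j, ContMDiffAt 𝓘(ℝ, Coord m) 𝓘(ℝ, ℝ) ∞ (fun x => bundleMatrix φ σ x i j) x) ∧
      ∀ x ∈ U, σ x ∈ symmGeneralizedInverses (a x) := by
  obtain ⟨A, b, c, h⟩ := hL.exists_isQuadraticIn hφ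
  obtain ⟨t, S, ht, hqt, hts, hS, hS'⟩ := exists_local_symm_generalized_inverse φ.open_target
    h.contDiffOn_A h.isSymm (k := k) (fun y hy => by
      have h1 := h.rank_eq hφ (φ.map_target hy)
      rwa [φ.right_inv hy, hk] at h1) (φ.map_source hq)
  refine ⟨φ.source ∩ φ ⁻¹' t, hφ.bundleMapOf S, φ.isOpen_inter_preimage ht, ⟨hq, hqt⟩,
    Set.inter_subset_left, fun x hx i j => ?_, fun x hx => ⟨fun v => ?_, fun z z' => ?_⟩⟩
  · exact hφ.contMDiffAt_bundleMatrix_bundleMapOf hx.1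
      (fun i j => (hS i j).contDiffAt (ht.mem_nhds hx.2)) i j
  · rw [h.form_eq hx.1, h.form_eq hx.1, hφ.velCoord_bundleMapOf S hx.1, Matrix.mulVec_mulVec,
      Matrix.mulVec_mulVec, (hS' _ hx.2).2]
  · obtain ⟨p, rfl⟩ := hφ.momOf_surjective hx.1 z
    obtain ⟨p', rfl⟩ := hφ.momOf_surjective hx.1 z'
    rw [momOf_apply, momOf_apply, hφ.velCoord_bundleMapOf S hx.1,
      hφ.velCoord_bundleMapOf S hx.1, Matrix.dotProduct_mulVec, ← Matrix.mulVec_transpose,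
      (hS' _ hx.2).1.eq, dotProduct_comm]

theorem IsQuadratic.exists_smooth_symmGeneralizedInverse [T2Space Q]
    [SecondCountableTopology Q]
    {L : Lagrangian m π} {a : ∀ q : Q, Vert m π q →ₗ[ℝ] MomFibre m π q} (hL : IsQuadratic L a)
    {k : ℕ} (hk : ∀ q : Q, Module.finrank ℝ (LinearMap.range (a q)) = k)
    (hchart : ∀ q : Q, ∃ φ : OpenPartialHomeomorph Q (Coord m),
      IsBundleChart m π φ ∧ q ∈ φ.source) :
    ∃ σ : ∀ q : Q, MomFibre m π q →ₗ[ℝ] Vert m π q, IsSmoothBundleMap σ ∧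
      ∀ q, σ q ∈ symmGeneralizedInverses (a q) := by
  have : LocallyCompactSpace Q := ChartedSpace.locallyCompactSpace (Coord m) Q
  choose φ hφ hqφ using hchart
  choose U τ hU hqU hUφ hτ hτ' using
    fun q => hL.exists_local_symmGeneralizedInverse hk (hφ q) (hqφ q)
  obtain ⟨ρ, hρ⟩ := SmoothPartitionOfUnity.exists_isSubordinate 𝓘(ℝ, Coord m)
    (isClosed_univ (X := Q)) U hU fun q _ => Set.mem_iUnion.mpr ⟨q, hqU q⟩
  refine ⟨fun q => ∑ᶠ k, ρ k q • τ k q, isSmoothBundleMap_of_contMDiffAt fun q₀ =>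
    ⟨φ q₀, hφ q₀, hqφ q₀, fun i j => ?_⟩, fun q => ?_⟩
  · refine (ρ.contMDiffAt_finsum (n := ⊤) (x₀ := q₀)
      (g := fun k x => bundleMatrix (φ q₀) (τ k) x i j) fun k hk => ?_).congr_of_eventuallyEq
      (Filter.Eventually.of_forall fun x => ?_)
    · exact (hφ k).contMDiffAt_bundleMatrix (hφ q₀) (hUφ k (hρ k hk)) (hqφ q₀)
        (hτ k q₀ (hρ k hk)) i j
    · have hfin : {k | ρ k x ≠ 0}.Finite := ρ.locallyFinite.point_finite x
      have h1 : ∑ᶠ k, ρ k x • τ k x = ∑ k ∈ hfin.toFinset, ρ k x • τ k x :=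
        finsum_eq_sum_of_support_subset _ fun k hk => by
          simpa using left_ne_zero_of_smul hk
      have h2 : ∑ᶠ k, ρ k x • bundleMatrix (φ q₀) (τ k) x i j =
          ∑ k ∈ hfin.toFinset, ρ k x • bundleMatrix (φ q₀) (τ k) x i j :=
        finsum_eq_sum_of_support_subset _ fun k hk => by
          simpa using left_ne_zero_of_smul hk
      beta_reduce
      rw [h2, bundleMatrix_apply, h1]
      simp only [bundleMatrix_apply, LinearMap.sum_apply, LinearMap.smul_apply,
        Submodule.coe_sum, Submodule.coe_smul, map_sum, map_smul, Finset.sum_apply, Pi.smul_apply]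
  · exact (convex_symmGeneralizedInverses (a q)).finsum_mem (fun k => ρ.nonneg k q)
      (ρ.sum_eq_one (Set.mem_univ q)) fun k hk => hτ' k q (hρ k (subset_closure hk))

end BundleMaps

/-! ### Gluing connections, extending velocities, and projecting to kernel connections. -/

section Connections

variable {m : ℕ} {Q : Type*} [TopologicalSpace Q] [ChartedSpace (Coord m) Q] {π : Q → ℝ}
  {φ ψ : OpenPartialHomeomorph Q (Coord m)} {q : Q}

section

theorem ContMDiffAt.matrix_mulVec {S : Q → Matrix (Fin m) (Fin m) ℝ} {w : Q → Fin m → ℝ}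
    (hS : ∀ i j, ContMDiffAt 𝓘(ℝ, Coord m) 𝓘(ℝ, ℝ) ∞ (fun x => S x i j) q)
    (hw : ContMDiffAt 𝓘(ℝ, Coord m) 𝓘(ℝ, Fin m → ℝ) ∞ w q) :
    ContMDiffAt 𝓘(ℝ, Coord m) 𝓘(ℝ, Fin m → ℝ) ∞ (fun x => S x *ᵥ w x) q :=
  contMDiffAt_pi_space.mpr fun i =>
    contMDiffAt_finsetSum (t := Finset.univ) (f := fun j x => S x i j * w x j) fun j _ =>
      (hS i j).mul (contMDiffAt_pi_space.mp hw j)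

variable [IsManifold 𝓘(ℝ, Coord m) ∞ Q]

/-- A jet field is smooth if and only if its velocity coordinates are. -/
theorem IsBundleChart.contMDiffAt_jetField_iff (hφ : IsBundleChart m π φ) (hq : q ∈ φ.source)
    (Γ : ∀ q : Q, JetFibre m π q) :
    ContMDiffAt 𝓘(ℝ, Coord m) 𝓘(ℝ, Coord m).tangent ∞
      (fun x => (⟨x, (Γ x).1⟩ : TangentBundle 𝓘(ℝ, Coord m) Q)) q ↔
    ContMDiffAt 𝓘(ℝ, Coord m) 𝓘(ℝ, Fin m → ℝ) ∞ (fun x => velCoord φ x (Γ x).1) q := by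
  rw [contMDiffAt_vectorField_iff hφ.1 hq]
  constructor
  · intro h
    exact contDiff_snd.contMDiff.contMDiffAt.comp q h
  · intro h
    refine ((contMDiffAt_const (c := (1 : ℝ))).prodMk_space h).congr_of_eventuallyEq ?_
    filter_upwards [φ.open_source.mem_nhds hq] with x hx
    exact (hφ.tangentEquiv_eq hx _).trans (Prod.ext (Γ x).2 rfl)

/-- Gluing of local connections with values in convex sets. -/
theorem exists_isConnection_of_local [T2Space Q] [SecondCountableTopology Q]
    (T : ∀ q : Q, Set (TangentSpace 𝓘(ℝ, Coord m) q)) (hT : ∀ q, Convex ℝ (T q))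
    (hloc : ∀ q₀ : Q, ∃ φ : OpenPartialHomeomorph Q (Coord m), IsBundleChart m π φ ∧
      ∃ U : Set Q, IsOpen U ∧ q₀ ∈ U ∧ U ⊆ φ.source ∧ ∃ W : Q → Fin m → ℝ,
        ContMDiffOn 𝓘(ℝ, Coord m) 𝓘(ℝ, Fin m → ℝ) ∞ W U ∧
        ∀ x ∈ U, ∀ j : JetFibre m π x, velCoord φ x j.1 = W x → j.1 ∈ T x) :
    ∃ Γ : ∀ q : Q, JetFibre m π q, IsConnection Γ ∧ ∀ q, (Γ q).1 ∈ T q := by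
  classical
  have : LocallyCompactSpace Q := ChartedSpace.locallyCompactSpace (Coord m) Q
  -- Being a jet is an affine condition on tangent vectors, so a connection can be glued as a
  -- section of `TQ` with values in convex sets.
  have hconv (q : Q) : Convex ℝ ({v | dtForm m π q v = 1} ∩ T q) := by
    refine Convex.inter ?_ (hT q)
    intro u hu v hv α β _ _ hαβ
    rw [Set.mem_ofPred_eq] at hu hv ⊢
    rw [map_add, map_smul, map_smul, hu, hv, smul_eq_mul, smul_eq_mul, mul_one, mul_one, hαβ]
  obtain ⟨s, hs⟩ := exists_contMDiffSection_forall_mem_convex_of_local (n := ⊤) 𝓘(ℝ, Coord m)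
    (F_fiber := Coord m) (fun q : Q => TangentSpace 𝓘(ℝ, Coord m) q) (fun q => {v | dtForm m π q v = 1} ∩ T q) hconv
    fun q₀ => by
      obtain ⟨φ, hφ, U, hU, hq₀, hUφ, W, hW, hWT⟩ := hloc q₀
      refine ⟨U, hU.mem_nhds hq₀, fun x => if hx : x ∈ φ.source then (hφ.jetOf hx (W x)).1 else 0,
        fun x hx => ContMDiffAt.contMDiffWithinAt ?_, fun x hx => ?_⟩
      · refine (contMDiffAt_vectorField_iff hφ.1 (hUφ hx) _).mpr ?_
        refine ((contMDiffAt_const (c := (1 : ℝ))).prodMk_space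
          (hW.contMDiffAt (hU.mem_nhds hx))).congr_of_eventuallyEq ?_
        filter_upwards [hU.mem_nhds hx] with x hx
        rw [dif_pos (hUφ hx)]
        exact (hφ.tangentEquiv_eq (hUφ hx) _).trans (Prod.ext (hφ.jetOf (hUφ hx) _).2
          (hφ.velCoord_jetOf (hUφ hx) _))
      · beta_reduce
        rw [dif_pos (hUφ hx)]
        exact ⟨(hφ.jetOf (hUφ hx) _).2, hWT x hx _ (hφ.velCoord_jetOf (hUφ hx) _)⟩
  exact ⟨fun q => ⟨s q, (hs q).1⟩, s.contMDiff, fun q => (hs q).2⟩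

theorem exists_isConnection [T2Space Q] [SecondCountableTopology Q]
    (hchart : ∀ q : Q, ∃ φ : OpenPartialHomeomorph Q (Coord m),
      IsBundleChart m π φ ∧ q ∈ φ.source) :
    ∃ Γ : ∀ q : Q, JetFibre m π q, IsConnection Γ := by
  obtain ⟨Γ, hΓ, -⟩ := exists_isConnection_of_local (π := π) (fun _ => Set.univ)
    (fun _ => convex_univ) fun q => by
      obtain ⟨φ, hφ, hq⟩ := hchart q
      exact ⟨φ, hφ, φ.source, φ.open_source, hq, subset_rfl, 0, contMDiffOn_const,
        fun _ _ _ _ => Set.mem_univ _⟩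
  exact ⟨Γ, hΓ⟩

end

section Curves

variable {c : ℝ → Q} (hc : IsSmoothSection m π c)
include hc

theorem IsSmoothSection.contDiffAt_coord (hφ : IsBundleChart m π φ) {t : ℝ}
    (ht : c t ∈ φ.source) : ContDiffAt ℝ ∞ (fun τ => φ (c τ)) t :=
  contMDiffAt_iff_contDiffAt.mp
    ((contMDiffAt_of_mem_maximalAtlas hφ.1 ht).comp t hc.1.contMDiffAt)

theorem IsSmoothSection.eventually_mem {s : Set Q} (hs : IsOpen s) {t : ℝ} (ht : c t ∈ s) :
    ∀ᶠ τ in nhds t, c τ ∈ s :=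
  hc.1.continuous.continuousAt.eventually_mem (hs.mem_nhds ht)

theorem IsSmoothSection.coord_eq (hφ : IsBundleChart m π φ) {t : ℝ} (ht : c t ∈ φ.source) :
    φ (c t) = (t, (φ (c t)).2) :=
  Prod.ext ((hφ.2 _ ht).trans (hc.2 t)) rfl

theorem IsSmoothSection.contDiffAt_velocity (hφ : IsBundleChart m π φ) {t : ℝ}
    (ht : c t ∈ φ.source) : ContDiffAt ℝ ∞ (deriv fun τ => (φ (c τ)).2) t :=
  (contDiff_snd.contDiffAt.comp t (hc.contDiffAt_coord hφ ht)).derivWithin (by simp)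

variable [IsManifold 𝓘(ℝ, Coord m) ∞ Q]

theorem IsSmoothSection.dtForm_mfderiv (hφ : IsBundleChart m π φ) {t : ℝ}
    (ht : c t ∈ φ.source) :
    dtForm m π (c t) (mfderiv 𝓘(ℝ, ℝ) 𝓘(ℝ, Coord m) c t (1 : ℝ)) = 1 ∧
    velCoord φ (c t) (mfderiv 𝓘(ℝ, ℝ) 𝓘(ℝ, Coord m) c t (1 : ℝ)) =
      deriv (fun τ => (φ (c τ)).2) t := by
  have hd : DifferentiableAt ℝ (fun τ => φ (c τ)) t :=
    (hc.contDiffAt_coord hφ ht).differentiableAt (by simp)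
  have h1 : mfderiv 𝓘(ℝ, Coord m) 𝓘(ℝ, Coord m) φ (c t)
      (mfderiv 𝓘(ℝ, ℝ) 𝓘(ℝ, Coord m) c t (1 : ℝ)) = deriv (fun τ => φ (c τ)) t := by
    have h2 := mfderiv_comp t (hφ.mdifferentiable.mdifferentiableAt ht)
      (hc.1.contMDiffAt.mdifferentiableAt (by simp))
    rw [mfderiv_eq_fderiv] at h2
    rw [← fderiv_apply_one_eq_deriv]
    exact (congrArg (fun f => f (1 : ℝ)) h2).symm
  have h3 : deriv (fun τ => φ (c τ)) t = (1, deriv (fun τ => (φ (c τ)).2) t) := by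
    refine HasDerivAt.deriv ((HasDerivAt.prodMk (hasDerivAt_id t)
      (hd.snd.hasDerivAt)).congr_of_eventuallyEq ?_)
    filter_upwards [hc.eventually_mem φ.open_source ht] with τ hτ using hc.coord_eq hφ hτ
  have h4 := (hφ.tangentEquiv_eq ht _).symm.trans (h1.trans h3)
  exact ⟨congrArg Prod.fst h4, congrArg Prod.snd h4⟩

/-- The velocity of a section extends to a connection. -/
theorem IsSmoothSection.exists_isConnection_extending [T2Space Q] [SecondCountableTopology Q]
    (hchart : ∀ q : Q, ∃ φ : OpenPartialHomeomorph Q (Coord m),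
      IsBundleChart m π φ ∧ q ∈ φ.source) :
    ∃ Γ : ∀ q : Q, JetFibre m π q, IsConnection Γ ∧
      ∀ t, (Γ (c t)).1 = mfderiv 𝓘(ℝ, ℝ) 𝓘(ℝ, Coord m) c t (1 : ℝ) := by
  obtain ⟨Γ, hΓ, h⟩ := exists_isConnection_of_local (π := π)
    -- This set is the single velocity vector at a point of the curve and the whole tangent space
    -- elsewhere; the cast only moves the velocity to the fibre over `q`.
    (fun q => {v | ∀ t, ∀ h : c t = q,
      v = h ▸ mfderiv 𝓘(ℝ, ℝ) 𝓘(ℝ, Coord m) c t (1 : ℝ)}) (fun q => by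
        rintro u hu v hv α β - - hαβ t rfl
        rw [hu t rfl, hv t rfl, ← add_smul, hαβ, one_smul]) fun q => by
      obtain ⟨φ, hφ, hq⟩ := hchart q
      refine ⟨φ, hφ, ?_⟩
      by_cases hcq : c (π q) = q
      · have hcq' : c (φ q).1 ∈ φ.source := by rwa [hφ.2 q hq, hcq]
        -- Near a point of the curve, the local extension has the components of `ċ` at the time of
        -- the base point, constant along the fibres in this chart.
        refine ⟨φ.source ∩ φ ⁻¹' ((fun y => c y.1) ⁻¹' φ.source), φ.isOpen_inter_preimage
          (φ.open_source.preimage (hc.1.continuous.comp continuous_fst)), ⟨hq, hcq'⟩,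
          Set.inter_subset_left, fun x => deriv (fun τ => (φ (c τ)).2) (φ x).1,
          fun x hx => ContMDiffAt.contMDiffWithinAt ?_, ?_⟩
        · exact ((hc.contDiffAt_velocity hφ hx.2).comp (φ x)
            contDiff_fst.contDiffAt).contMDiffAt.comp x
            (contMDiffAt_of_mem_maximalAtlas hφ.1 hx.1)
        · rintro x hx j hj t rfl
          obtain ⟨h1, h2⟩ := hc.dtForm_mfderiv hφ hx.1
          refine hφ.tangent_ext hx.1 (j.2.trans h1.symm) (hj.trans (h2.trans ?_).symm)
          beta_reduce
          rw [hφ.2 _ hx.1, hc.2]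
      · have h1 : ContinuousAt π q := by
          refine ((continuous_fst.continuousAt.comp (φ.continuousAt hq)).congr ?_)
          filter_upwards [φ.open_source.mem_nhds hq] with x hx using hφ.2 x hx
        -- Off the curve a whole neighbourhood misses it, since the image of `c` is `{x | c (π x) =
        -- x}` and `Q` is Hausdorff; there the constraint is void and zero components will do.
        have h2 : ∀ᶠ x in nhds q, c (π x) ≠ x :=
          ((hc.1.continuous.continuousAt.comp h1).ne_iff_eventually_ne continuousAt_id).mp hcq
        obtain ⟨U, hU, hUo, hqU⟩ := mem_nhds_iff.mp (h2.and (φ.open_source.mem_nhds hq))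
        refine ⟨U, hUo, hqU, fun x hx => (hU hx).2, 0, contMDiffOn_const, ?_⟩
        rintro x hx j - t rfl
        exact ((hU hx).1 (by rw [hc.2])).elim
  exact ⟨Γ, hΓ, fun t => h (c t) t rfl⟩

end Curves

variable [IsManifold 𝓘(ℝ, Coord m) ∞ Q] {L : Lagrangian m π} {a : ∀ q : Q, Vert m π q →ₗ[ℝ] MomFibre m π q}

/-- The projection of a connection to the connections with values in the kernel of the Legendre
map. -/
theorem IsConnection.isKernelConnection_sub (hL : IsQuadratic L a)
    (hchart : ∀ q : Q, ∃ φ : OpenPartialHomeomorph Q (Coord m),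
      IsBundleChart m π φ ∧ q ∈ φ.source)
    {σ : ∀ q : Q, MomFibre m π q →ₗ[ℝ] Vert m π q} (hσ : IsSigmaMap L a σ)
    {Γ : ∀ q : Q, JetFibre m π q} (hΓ : IsConnection Γ) :
    IsKernelConnection L fun q => (Γ q).add (-σ q (legendre L q (Γ q))) := by
  refine ⟨fun q => ?_, fun q => ?_⟩
  · obtain ⟨φ, hφ, hq⟩ := hchart q
    obtain ⟨A, b, c, h⟩ := hL.exists_isQuadraticIn hφ
    obtain ⟨S, hS, hS'⟩ := hσ.1 φ hφ
    have hcomp {F : Type} [NormedAddCommGroup F] [NormedSpace ℝ F] {f : Coord m → F}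
        (hf : ContDiffOn ℝ ∞ f φ.target) :
        ContMDiffAt 𝓘(ℝ, Coord m) 𝓘(ℝ, F) ∞ (fun x => f (φ x)) q :=
      (hf.contDiffAt (φ.open_target.mem_nhds (φ.map_source hq))).contMDiffAt.comp q
        (contMDiffAt_of_mem_maximalAtlas hφ.1 hq)
    have h1 := (hφ.contMDiffAt_jetField_iff hq Γ).mp (hΓ q)
    -- In coordinates the new connection is `Γ - S (A Γ + b)`.
    refine (hφ.contMDiffAt_jetField_iff hq _).mpr ((h1.sub (ContMDiffAt.matrix_mulVec
      (fun i j => hcomp (hS i j)) ((ContMDiffAt.matrix_mulVec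
        (fun i j => hcomp (h.contDiffOn_A i j)) h1).add
          (hcomp h.contDiffOn_b)))).congr_of_eventuallyEq ?_)
    filter_upwards [φ.open_source.mem_nhds hq] with x hx
    rw [JetFibre.velCoord_add, h.legendre_eq hx, Submodule.coe_neg, map_neg, hS' x hx,
      sub_eq_add_neg]
    rfl
  · obtain ⟨φ, hφ, hq⟩ := hchart q
    rw [hL.legendre_add hφ hq, map_neg, hσ.2 q _ ⟨_, rfl⟩, add_neg_cancel]

end Connections

/-! ### Calculus in coordinates and critical points. -/

section CoordinateSmoothness

variable {E : Type*} [NormedAddCommGroup E] [NormedSpace ℝ E] {m : ℕ} {s : Set E}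
  {n : WithTop ℕ∞}

theorem ContDiffOn.dotProduct {u v : E → Fin m → ℝ} (hu : ContDiffOn ℝ n u s)
    (hv : ContDiffOn ℝ n v s) : ContDiffOn ℝ n (fun x => u x ⬝ᵥ v x) s :=
  ContDiffOn.sum fun i _ => (contDiffOn_pi.mp hu i).mul (contDiffOn_pi.mp hv i)

theorem ContDiffOn.mulVec {A : E → Matrix (Fin m) (Fin m) ℝ} {v : E → Fin m → ℝ}
    (hA : ∀ i j, ContDiffOn ℝ n (fun x => A x i j) s) (hv : ContDiffOn ℝ n v s) :
    ContDiffOn ℝ n (fun x => A x *ᵥ v x) s :=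
  contDiffOn_pi.mpr fun i => ContDiffOn.dotProduct (contDiffOn_pi.mpr fun j => hA i j) hv

/-- Reduces the Fréchet derivative in `partialDeriv` to a one-variable derivative, which for
quadratic functions is explicit. -/
theorem partialDeriv_eq {f : (Fin m → ℝ) → ℝ} {x : Fin m → ℝ} (hf : DifferentiableAt ℝ f x)
    {i : Fin m} {d : ℝ} (h : HasDerivAt (fun s : ℝ => f (x + s • Pi.single i 1)) d 0) :
    partialDeriv f i x = d :=
  HasDerivAt.unique (hf.hasFDerivAt.hasLineDerivAt (Pi.single i 1)) h

/-- At a critical point of `k (x₀, ·)`, the total derivative of `x ↦ k (x, W x)` is the partial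
derivative. -/
theorem fderiv_comp_critical {F : Type*} [NormedAddCommGroup F] [NormedSpace ℝ F] {k : E × F → ℝ}
    {W : E → F} {x₀ : E} (hk : DifferentiableAt ℝ k (x₀, W x₀)) (hW : DifferentiableAt ℝ W x₀)
    (hcrit : ∀ u, HasDerivAt (fun s : ℝ => k (x₀, W x₀ + s • u)) 0 0) :
    fderiv ℝ (fun x => k (x, W x)) x₀ = fderiv ℝ (fun x => k (x, W x₀)) x₀ := by
  have h0 (u : F) : fderiv ℝ k (x₀, W x₀) (0, u) = 0 := by
    have h1 := hk.hasFDerivAt.hasLineDerivAt (0, u)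
    refine HasDerivAt.unique (h1 : HasDerivAt _ _ _) ?_
    simpa using hcrit u
  have h1 : HasFDerivAt (fun x => k (x, W x)) _ x₀ :=
    HasFDerivAt.comp x₀ (f := fun x => (x, W x)) hk.hasFDerivAt
      ((hasFDerivAt_id x₀).prodMk hW.hasFDerivAt)
  have h2 : HasFDerivAt (fun x => k (x, W x₀)) _ x₀ :=
    HasFDerivAt.comp x₀ (f := fun x => (x, W x₀)) hk.hasFDerivAt
      ((hasFDerivAt_id x₀).prodMk (hasFDerivAt_const (W x₀) x₀))
  rw [h1.fderiv, h2.fderiv]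
  ext e
  have h3 : (e, fderiv ℝ W x₀ e) = (e, (0 : F)) + (0, fderiv ℝ W x₀ e) := by simp
  simp only [ContinuousLinearMap.comp_apply, ContinuousLinearMap.prod_apply,
    ContinuousLinearMap.id_apply, zero_apply]
  rw [h3, map_add, h0, add_zero]

end CoordinateSmoothness

/-! ### The Hamiltonian map of `H_Φ + Φ*L` and weak association. -/

section WeaklyAssociated

variable {m : ℕ} {Q : Type*} [TopologicalSpace Q] [ChartedSpace (Coord m) Q] {π : Q → ℝ}
  {φ : OpenPartialHomeomorph Q (Coord m)} {q : Q}
  {L : Lagrangian m π} {a : ∀ q : Q, Vert m π q →ₗ[ℝ] MomFibre m π q}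
  {A : Coord m → Matrix (Fin m) (Fin m) ℝ} {b : Coord m → Fin m → ℝ} {c : Coord m → ℝ}
  {σ : ∀ q : Q, MomFibre m π q →ₗ[ℝ] Vert m π q} {Γ : ∀ q : Q, JetFibre m π q}
  {S : Coord m → Matrix (Fin m) (Fin m) ℝ}

theorem formOfMap_apply_vert (Φ : ∀ q : Q, MomFibre m π q → JetFibre m π q) (z : MomFibre m π q)
    (v : Vert m π q) : formOfMap L Φ q z v.1 = z v := by
  have h0 : dtForm m π q v.1 = 0 := LinearMap.mem_ker.mp v.2
  have h1 : vertProj (Φ q z) v.1 = v := by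
    refine Subtype.ext ?_
    change v.1 - dtForm m π q v.1 • (Φ q z).1 = v.1
    rw [h0, zero_smul, sub_zero]
  change z (vertProj (Φ q z) v.1) + L q (Φ q z) * dtForm m π q v.1 = z v
  rw [h0, h1, mul_zero, add_zero]

theorem IsQuadraticIn.form_legendre_coord (h : IsQuadraticIn L a φ A b c)
    [IsManifold 𝓘(ℝ, Coord m) ∞ Q] (hφ : IsBundleChart m π φ)
    (hq : q ∈ φ.source) (hΓ : legendre L q (Γ q) = 0) :
    A (φ q) *ᵥ velCoord φ q (Γ q).1 + b (φ q) = 0 := by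
  refine hφ.momOf_injective hq ?_
  rw [← h.legendre_eq hq, hΓ]
  exact (map_zero (hφ.momEquiv hq)).symm

variable [IsManifold 𝓘(ℝ, Coord m) ∞ Q]

/-- The velocity coordinates of a jet field as functions of the coordinates of the base point. -/
noncomputable def coordJet (φ : OpenPartialHomeomorph Q (Coord m)) (Γ : ∀ q : Q, JetFibre m π q)
    (y : Coord m) : Fin m → ℝ :=
  velCoord φ (φ.symm y) (Γ (φ.symm y)).1

omit [IsManifold 𝓘(ℝ, Coord m) ∞ Q] in
theorem coordJet_apply (hq : q ∈ φ.source) : coordJet φ Γ (φ q) = velCoord φ q (Γ q).1 := by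
  rw [coordJet, φ.left_inv hq]

theorem IsConnection.contDiffOn_coordJet (hΓ : IsConnection Γ) (hφ : IsBundleChart m π φ) :
    ContDiffOn ℝ ∞ (coordJet φ Γ) φ.target := by
  rw [← contMDiffOn_iff_contDiffOn]
  have h1 : ContMDiffOn 𝓘(ℝ, Coord m) 𝓘(ℝ, Fin m → ℝ) ∞ (fun x => velCoord φ x (Γ x).1)
      φ.source := fun x hx =>
    ((hφ.contMDiffAt_jetField_iff hx Γ).mp (hΓ x)).contMDiffWithinAt
  exact h1.comp (contMDiffOn_symm_of_mem_maximalAtlas hφ.1) fun y hy => φ.map_target hy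

theorem IsQuadraticIn.contDiffOn_coordLagrangian (h : IsQuadraticIn L a φ A b c)
    (hφ : IsBundleChart m π φ) :
    ContDiffOn ℝ ∞ (fun yw : Coord m × (Fin m → ℝ) => coordLagrangian L φ yw.1 yw.2)
      (φ.target ×ˢ Set.univ) := by
  have hfst {F : Type} [NormedAddCommGroup F] [NormedSpace ℝ F] {f : Coord m → F}
      (hf : ContDiffOn ℝ ∞ f φ.target) :
      ContDiffOn ℝ ∞ (fun yw : Coord m × (Fin m → ℝ) => f yw.1) (φ.target ×ˢ Set.univ) :=
    hf.comp contDiffOn_fst fun yw hyw => hyw.1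
  have hsnd : ContDiffOn ℝ ∞ (fun yw : Coord m × (Fin m → ℝ) => yw.2) (φ.target ×ˢ Set.univ) :=
    contDiffOn_snd
  refine (((contDiffOn_const (c := (1 / 2 : ℝ))).mul (hsnd.dotProduct (ContDiffOn.mulVec
    (fun i j => hfst (h.contDiffOn_A i j)) hsnd))).add
    ((hfst h.contDiffOn_b).dotProduct hsnd)).add (hfst h.contDiffOn_c) |>.congr ?_
  intro yw hyw
  exact h.coordLagrangian_eq hφ hyw.1 yw.2

theorem IsQuadraticIn.hasDerivAt_coordLagrangian (h : IsQuadraticIn L a φ A b c)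
    (hφ : IsBundleChart m π φ) {y : Coord m} (hy : y ∈ φ.target) (w u : Fin m → ℝ) :
    HasDerivAt (fun s : ℝ => coordLagrangian L φ y (w + s • u)) ((A y *ᵥ w + b y) ⬝ᵥ u) 0 := by
  simp only [h.coordLagrangian_eq hφ hy]
  exact hasDerivAt_quadratic (h.isSymm y hy) _ _ _ _

theorem IsQuadraticIn.partialDeriv_coordLagrangian (h : IsQuadraticIn L a φ A b c)
    (hφ : IsBundleChart m π φ) {y : Coord m} (hy : y ∈ φ.target) (w : Fin m → ℝ) (i : Fin m) :
    partialDeriv (coordLagrangian L φ y) i w = (A y *ᵥ w + b y) i := by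
  have hd : DifferentiableAt ℝ (coordLagrangian L φ y) w := by
    have h1 := (h.contDiffOn_coordLagrangian hφ).contDiffAt (x := (y, w))
      ((φ.open_target.prod isOpen_univ).mem_nhds ⟨hy, Set.mem_univ _⟩)
    exact (h1.comp w (f := fun w => (y, w)) (contDiffAt_const.prodMk contDiffAt_id)
      |>.differentiableAt (by simp))
  rw [partialDeriv_eq hd (h.hasDerivAt_coordLagrangian hφ hy w _)]
  simp

section Affine

variable (hφ : IsBundleChart m π φ)
  (hS : ∀ q ∈ φ.source, ∀ p : Fin m → ℝ, velCoord φ q (σ q (momOf φ q p)) = S (φ q) *ᵥ p)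
include hφ hS

/-- The Hamiltonian of `H_Φ + Φ*L` for `Φ = Γ + σ` in a bundle chart. -/
theorem IsBundleChart.coordHamiltonian_affineMap {y : Coord m} (hy : y ∈ φ.target)
    (p : Fin m → ℝ) :
    coordHamiltonian (formOfMap L (affineMap Γ σ)) φ y p =
      p ⬝ᵥ (coordJet φ Γ y + S y *ᵥ p) - coordLagrangian L φ y (coordJet φ Γ y + S y *ᵥ p) := by
  have h1 : velCoord φ (φ.symm y) (affineMap Γ σ (φ.symm y) (momOf φ (φ.symm y) p)).1 =
      coordJet φ Γ y + S y *ᵥ p := by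
    rw [affineMap, JetFibre.velCoord_add, hS _ (φ.map_target hy), φ.right_inv hy]
    rfl
  rw [hφ.coordHamiltonian_formOfMap hy, h1]

theorem IsQuadraticIn.contDiffOn_coordHamiltonian (h : IsQuadraticIn L a φ A b c)
    (hS' : ∀ i j, ContDiffOn ℝ ∞ (fun y => S y i j) φ.target) (hΓ : IsConnection Γ) :
    ContDiffOn ℝ ∞ (fun yp : Coord m × (Fin m → ℝ) =>
      coordHamiltonian (formOfMap L (affineMap Γ σ)) φ yp.1 yp.2) (φ.target ×ˢ Set.univ) := by
  have hfst {F : Type} [NormedAddCommGroup F] [NormedSpace ℝ F] {f : Coord m → F}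
      (hf : ContDiffOn ℝ ∞ f φ.target) :
      ContDiffOn ℝ ∞ (fun yw : Coord m × (Fin m → ℝ) => f yw.1) (φ.target ×ˢ Set.univ) :=
    hf.comp contDiffOn_fst fun yw hyw => hyw.1
  have hsnd : ContDiffOn ℝ ∞ (fun yw : Coord m × (Fin m → ℝ) => yw.2) (φ.target ×ˢ Set.univ) :=
    contDiffOn_snd
  have hw : ContDiffOn ℝ ∞ (fun yp : Coord m × (Fin m → ℝ) =>
      coordJet φ Γ yp.1 + S yp.1 *ᵥ yp.2) (φ.target ×ˢ Set.univ) :=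
    (hfst (hΓ.contDiffOn_coordJet hφ)).add (ContDiffOn.mulVec (fun i j => hfst (hS' i j)) hsnd)
  refine ((hsnd.dotProduct hw).sub ((h.contDiffOn_coordLagrangian hφ).comp
    (contDiffOn_fst.prodMk hw) fun yp hyp => ⟨hyp.1, Set.mem_univ _⟩)).congr fun yp hyp => ?_
  exact hφ.coordHamiltonian_affineMap hS hyp.1 yp.2

/-- Chain rule for `p · w(p) - 𝓛(w(p))` with `w(p) = Γ + S p`: differentiating the explicit `p`
gives `w`, and the rest is `Sᵀ` applied to `p - ∂𝓛/∂w`. `Γ` is an arbitrary connection here, and the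
transpose remains because `S` need not be symmetric. -/
theorem IsQuadraticIn.partialDeriv_coordHamiltonian (h : IsQuadraticIn L a φ A b c)
    (hS' : ∀ i j, ContDiffOn ℝ ∞ (fun y => S y i j) φ.target) (hΓ : IsConnection Γ)
    {y : Coord m} (hy : y ∈ φ.target) (p : Fin m → ℝ) (i : Fin m) :
    partialDeriv (coordHamiltonian (formOfMap L (affineMap Γ σ)) φ y) i p =
      (coordJet φ Γ y + S y *ᵥ p + (S y)ᵀ *ᵥ
        (p - (A y *ᵥ (coordJet φ Γ y + S y *ᵥ p) + b y))) i := by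
  have hd : DifferentiableAt ℝ (coordHamiltonian (formOfMap L (affineMap Γ σ)) φ y) p := by
    have h1 := (h.contDiffOn_coordHamiltonian hφ hS hS' hΓ).contDiffAt (x := (y, p))
      ((φ.open_target.prod isOpen_univ).mem_nhds ⟨hy, Set.mem_univ _⟩)
    exact (h1.comp p (f := fun p => (y, p)) (contDiffAt_const.prodMk contDiffAt_id)
      |>.differentiableAt (by simp))
  refine partialDeriv_eq hd ?_
  set w := coordJet φ Γ y + S y *ᵥ p with hw
  set e : Fin m → ℝ := Pi.single i 1 with he
  have h1 (s : ℝ) : coordJet φ Γ y + S y *ᵥ (p + s • e) = w + s • S y *ᵥ e := by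
    rw [hw, Matrix.mulVec_add, Matrix.mulVec_smul, add_assoc]
  have h2 : HasDerivAt (fun s : ℝ => (p + s • e) ⬝ᵥ (w + s • S y *ᵥ e))
      (e ⬝ᵥ w + p ⬝ᵥ S y *ᵥ e) 0 := by
    have h3 : (fun s : ℝ => (p + s • e) ⬝ᵥ (w + s • S y *ᵥ e)) = fun s : ℝ => p ⬝ᵥ w +
        (e ⬝ᵥ w + p ⬝ᵥ S y *ᵥ e) * s + (e ⬝ᵥ S y *ᵥ e) * s ^ 2 := by
      funext s
      simp only [dotProduct_add, add_dotProduct, smul_dotProduct, dotProduct_smul, smul_eq_mul]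
      ring
    rw [h3]
    have h4 := (((hasDerivAt_id (0 : ℝ)).const_mul (e ⬝ᵥ w + p ⬝ᵥ S y *ᵥ e)).const_add
      (p ⬝ᵥ w)).add (((hasDerivAt_id (0 : ℝ)).pow 2).const_mul (e ⬝ᵥ S y *ᵥ e))
    simpa using! h4
  have h3 := h2.sub (h.hasDerivAt_coordLagrangian hφ hy w (S y *ᵥ e))
  simp only [hφ.coordHamiltonian_affineMap hS hy, h1]
  convert! h3 using 1
  have h4 (x : Fin m → ℝ) : x i = e ⬝ᵥ x := by simp [he]
  have h5 (r : Fin m → ℝ) : ((S y)ᵀ *ᵥ r) i = r ⬝ᵥ S y *ᵥ e := by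
    rw [h4 ((S y)ᵀ *ᵥ r), Matrix.dotProduct_mulVec, Matrix.vecMul_transpose, dotProduct_comm]
  rw [Pi.add_apply, h4 w, h5, sub_dotProduct]
  ring

end Affine

/-- The dual of `σ` takes values in the bidual of the vertical space, which is the space itself in
finite dimension. -/
theorem IsBundleChart.exists_transpose (hφ : IsBundleChart m π φ) (hq : q ∈ φ.source)
    (σ : MomFibre m π q →ₗ[ℝ] Vert m π q) :
    ∃ τ : MomFibre m π q →ₗ[ℝ] Vert m π q, ∀ z z' : MomFibre m π q, z' (τ z) = z (σ z') := by
  have : FiniteDimensional ℝ (Vert m π q) := Module.Finite.equiv (hφ.vertEquiv hq).symm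
  exact ⟨(Module.evalEquiv ℝ (Vert m π q)).symm.toLinearMap ∘ₗ σ.dualMap, fun z z' =>
    Module.apply_evalEquiv_symm_apply ℝ (Vert m π q) z' (σ.dualMap z)⟩

omit [IsManifold 𝓘(ℝ, Coord m) ∞ Q] in
theorem velCoord_transpose
    {σ τ : MomFibre m π q →ₗ[ℝ] Vert m π q} (hτ : ∀ z z' : MomFibre m π q, z' (τ z) = z (σ z'))
    {S : Matrix (Fin m) (Fin m) ℝ}
    (hS : ∀ p : Fin m → ℝ, velCoord φ q (σ (momOf φ q p)) = S *ᵥ p) (p : Fin m → ℝ) :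
    velCoord φ q (τ (momOf φ q p)) = Sᵀ *ᵥ p := by
  refine dotProduct_eq _ _ fun p' => ?_
  have h := hτ (momOf φ q p) (momOf φ q p')
  rw [momOf_apply, momOf_apply, hS] at h
  rw [dotProduct_comm, h, Matrix.dotProduct_mulVec, Matrix.mulVec_transpose]

/-- The Hamiltonian form `H_Φ + Φ*L` with `Φ = Γ + σ` is weakly associated with `L`. -/
theorem IsKernelConnection.isWeaklyAssociated (hL : IsQuadratic L a)
    (hchart : ∀ q : Q, ∃ φ : OpenPartialHomeomorph Q (Coord m),
      IsBundleChart m π φ ∧ q ∈ φ.source)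
    (hσ : IsSigmaMap L a σ) (hΓ : IsKernelConnection L Γ) :
    IsWeaklyAssociated L (formOfMap L (affineMap Γ σ)) := by
  have hτ (q : Q) : ∃ τ : MomFibre m π q →ₗ[ℝ] Vert m π q,
      ∀ z z' : MomFibre m π q, z' (τ z) = z (σ q z') := by
    obtain ⟨φ, hφ, hq⟩ := hchart q
    exact hφ.exists_transpose hq (σ q)
  choose τ hτ using hτ
  -- The Hamiltonian map in chart-free form, `Φ(z) + σᵀ(z - a σ z)`; here `L̂ Φ(z) = a σ z` because
  -- `L̂ Γ = 0`. Its correction to `Φ` vanishes on `N_L`.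
  let Ψ : ∀ q : Q, MomFibre m π q → JetFibre m π q := fun q z =>
    (affineMap Γ σ q z).add (τ q (z - a q (σ q z)))
  have hΨ (q : Q) (z : MomFibre m π q) (hz : z ∈ constraintSpace L q) :
      Ψ q z = affineMap Γ σ q z := by
    simp only [Ψ]
    rw [hσ.2 q z hz, sub_self, map_zero]
    exact Subtype.ext (add_zero _)
  refine ⟨⟨fun q z v => formOfMap_apply_vert _ z v, fun φ hφ => ?_⟩, Ψ, fun φ hφ q hq p i => ?_,
    fun q j => ?_, fun q z hz => ?_⟩
  · obtain ⟨A, b, c, h⟩ := hL.exists_isQuadraticIn hφ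
    obtain ⟨S, hS', hS⟩ := hσ.1 φ hφ
    exact h.contDiffOn_coordHamiltonian hφ hS hS' hΓ.1
  · obtain ⟨A, b, c, h⟩ := hL.exists_isQuadraticIn hφ
    obtain ⟨S, hS', hS⟩ := hσ.1 φ hφ
    rw [h.partialDeriv_coordHamiltonian hφ hS hS' hΓ.1 (φ.map_source hq), coordJet_apply hq]
    have h1 : momOf φ q p - a q (σ q (momOf φ q p)) =
        momOf φ q (p - A (φ q) *ᵥ S (φ q) *ᵥ p) := by
      rw [h.form_eq hq, hS q hq]
      exact (map_sub (hφ.momEquiv hq) _ _).symm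
    have h2 := h.form_legendre_coord hφ hq (hΓ.2 q)
    have h3 : A (φ q) *ᵥ (velCoord φ q (Γ q).1 + S (φ q) *ᵥ p) + b (φ q) =
        A (φ q) *ᵥ S (φ q) *ᵥ p := by
      rw [Matrix.mulVec_add, add_right_comm, h2, zero_add]
    rw [h3]
    simp only [Ψ, affineMap]
    rw [JetFibre.velCoord_add, JetFibre.velCoord_add, hS q hq, h1,
      velCoord_transpose (hτ q) (hS q hq)]
  · obtain ⟨φ, hφ, hq⟩ := hchart q
    -- For `z` in `N_L`: `L̂(Γ + σ z) = L̂ Γ + a σ z = z`.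
    rw [hΨ q _ ⟨j, rfl⟩, affineMap, hL.legendre_add hφ hq, hΓ.2, zero_add, hσ.2 q _ ⟨j, rfl⟩]
  · simp only [formOfMap, hΨ q z hz]

end WeaklyAssociated

/-! ### Lifting Lagrange solutions to Hamilton solutions. -/

section Completeness

variable {m : ℕ} {Q : Type*} [TopologicalSpace Q] [ChartedSpace (Coord m) Q] {π : Q → ℝ}
  {φ : OpenPartialHomeomorph Q (Coord m)} [IsManifold 𝓘(ℝ, Coord m) ∞ Q]
  {L : Lagrangian m π} {a : ∀ q : Q, Vert m π q →ₗ[ℝ] MomFibre m π q}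
  {A : Coord m → Matrix (Fin m) (Fin m) ℝ} {b : Coord m → Fin m → ℝ} {c : Coord m → ℝ}
  {σ : ∀ q : Q, MomFibre m π q →ₗ[ℝ] Vert m π q} {Γ : ∀ q : Q, JetFibre m π q}
  {S : Coord m → Matrix (Fin m) (Fin m) ℝ}

/-- Where `p` is the momentum of the jet `Φ(p)`, the spatial derivatives of the Hamiltonian are
opposite to those of the Lagrangian. -/
theorem IsQuadraticIn.partialDeriv_coordHamiltonian_base (h : IsQuadraticIn L a φ A b c)
    (hφ : IsBundleChart m π φ)
    (hS : ∀ q ∈ φ.source, ∀ p : Fin m → ℝ, velCoord φ q (σ q (momOf φ q p)) = S (φ q) *ᵥ p)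
    (hS' : ∀ i j, ContDiffOn ℝ ∞ (fun y => S y i j) φ.target) (hΓ : IsConnection Γ)
    {t : ℝ} {x₀ p w : Fin m → ℝ} (hx₀ : (t, x₀) ∈ φ.target)
    (hw : coordJet φ Γ (t, x₀) + S (t, x₀) *ᵥ p = w) (hp : A (t, x₀) *ᵥ w + b (t, x₀) = p)
    (i : Fin m) :
    partialDeriv (fun x => coordHamiltonian (formOfMap L (affineMap Γ σ)) φ (t, x) p) i x₀ =
      -partialDeriv (fun x => coordLagrangian L φ (t, x) w) i x₀ := by
  -- The Hamiltonian is `k (x, W x)`. By `hp` the velocity `w` is critical for `k (x₀, ·)`, so only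
  -- the explicit dependence on `x` through `𝓛` contributes.
  let k : (Fin m → ℝ) × (Fin m → ℝ) → ℝ := fun xv =>
    p ⬝ᵥ xv.2 - coordLagrangian L φ (t, xv.1) xv.2
  let W : (Fin m → ℝ) → Fin m → ℝ := fun x => coordJet φ Γ (t, x) + S (t, x) *ᵥ p
  have hW0 : W x₀ = w := hw
  have hin : ContDiffAt ℝ ∞ (fun x : Fin m → ℝ => (t, x)) x₀ :=
    contDiffAt_const.prodMk contDiffAt_id
  have hL1 : ContDiffAt ℝ ∞ (fun xv : (Fin m → ℝ) × (Fin m → ℝ) =>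
      coordLagrangian L φ (t, xv.1) xv.2) (x₀, w) :=
    ((h.contDiffOn_coordLagrangian hφ).contDiffAt (x := ((t, x₀), w))
      ((φ.open_target.prod isOpen_univ).mem_nhds ⟨hx₀, Set.mem_univ _⟩)).comp (x₀, w)
      (f := fun xv : (Fin m → ℝ) × (Fin m → ℝ) => ((t, xv.1), xv.2))
      ((contDiffAt_const.prodMk contDiffAt_fst).prodMk contDiffAt_snd)
  have hk : DifferentiableAt ℝ k (x₀, W x₀) := by
    rw [hW0]
    refine DifferentiableAt.sub ?_ (hL1.differentiableAt (by simp))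
    exact (contDiffOn_const.dotProduct contDiffOn_snd (s := Set.univ) (n := 1)).contDiffAt
      Filter.univ_mem |>.differentiableAt (by simp)
  have hW : DifferentiableAt ℝ W x₀ := by
    have h1 : ContDiffOn ℝ ∞ (fun y => coordJet φ Γ y + S y *ᵥ p) φ.target :=
      (hΓ.contDiffOn_coordJet hφ).add (ContDiffOn.mulVec hS' contDiffOn_const)
    exact ((h1.contDiffAt (φ.open_target.mem_nhds hx₀)).comp x₀ hin).differentiableAt (by simp)
  have hcrit (u : Fin m → ℝ) : HasDerivAt (fun s : ℝ => k (x₀, W x₀ + s • u)) 0 0 := by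
    have h1 := h.hasDerivAt_coordLagrangian hφ hx₀ w u
    rw [hp] at h1
    have h2 : HasDerivAt (fun s : ℝ => p ⬝ᵥ (w + s • u)) (p ⬝ᵥ u) 0 := by
      have h3 := ((hasDerivAt_id (0 : ℝ)).mul_const (p ⬝ᵥ u)).const_add (p ⬝ᵥ w)
      simpa [dotProduct_add, dotProduct_smul] using! h3
    have h3 := h2.sub h1
    rw [sub_self] at h3
    rw [hW0]
    exact h3
  have h1 := fderiv_comp_critical hk hW hcrit
  have h2 : (fun x => coordHamiltonian (formOfMap L (affineMap Γ σ)) φ (t, x) p) =ᶠ[nhds x₀]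
      fun x => k (x, W x) := by
    filter_upwards [hin.continuousAt.eventually_mem (φ.open_target.mem_nhds hx₀)] with x hx
    exact hφ.coordHamiltonian_affineMap hS hx p
  have h3 : fderiv ℝ (fun x => k (x, W x₀)) x₀ =
      -fderiv ℝ (fun x => coordLagrangian L φ (t, x) w) x₀ := by
    rw [hW0]
    exact fderiv_const_sub (f := fun x => coordLagrangian L φ (t, x) w) (x := x₀) (p ⬝ᵥ w)
  rw [partialDeriv, partialDeriv, h2.fderiv_eq, h1, h3]
  rfl

/-- A solution of the Lagrange equations is the projection of a solution of the Hamilton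
equations, if `Γ` agrees along it with the difference of its velocity and `σ ∘ L̂`. -/
theorem IsLagrangeSolution.exists_isHamiltonSolution (hL : IsQuadratic L a)
    (hσ : IsSmoothBundleMap σ) {Γ₀ : ∀ q : Q, JetFibre m π q} {c : ℝ → Q}
    (hc : IsLagrangeSolution L c)
    (hΓ₀ : ∀ t, (Γ₀ (c t)).1 = mfderiv 𝓘(ℝ, ℝ) 𝓘(ℝ, Coord m) c t (1 : ℝ))
    (hΓ : IsConnection fun q => (Γ₀ q).add (-σ q (legendre L q (Γ₀ q)))) :
    ∃ r : ℝ → LegendreBundle m π, IsHamiltonSolution (formOfMap L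
      (affineMap (fun q => (Γ₀ q).add (-σ q (legendre L q (Γ₀ q)))) σ)) r ∧
      ∀ t, (r t).1 = c t := by
  -- The lift is `r = L̂(ċ)`, since `Γ₀` restricts to the velocity along `c`.
  refine ⟨fun t => ⟨c t, legendre L (c t) (Γ₀ (c t))⟩, ⟨hc.1, fun φ hφ => ?_⟩, fun t => rfl⟩
  obtain ⟨A, b, c₀, h⟩ := hL.exists_isQuadraticIn hφ
  obtain ⟨S, hS', hS⟩ := hσ φ hφ
  let w : ℝ → Fin m → ℝ := deriv fun τ => (φ (c τ)).2
  let p : ℝ → Fin m → ℝ := fun t => A (φ (c t)) *ᵥ w t + b (φ (c t))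
  have hvel (t : ℝ) (ht : c t ∈ φ.source) : velCoord φ (c t) (Γ₀ (c t)).1 = w t := by
    rw [hΓ₀]
    exact (hc.1.dtForm_mfderiv hφ ht).2
  have hleg (t : ℝ) (ht : c t ∈ φ.source) :
      legendre L (c t) (Γ₀ (c t)) = momOf φ (c t) (p t) := by
    rw [h.legendre_eq ht, hvel t ht]
  have hcoord : ContDiffOn ℝ ∞ (fun t => φ (c t)) {t | c t ∈ φ.source} := fun t ht =>
    (hc.1.contDiffAt_coord hφ ht).contDiffWithinAt
  have hmaps : Set.MapsTo (fun t => φ (c t)) {t | c t ∈ φ.source} φ.target := fun t ht =>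
    φ.map_source ht
  have hpsmooth : ContDiffOn ℝ ∞ p {t | c t ∈ φ.source} :=
    (ContDiffOn.mulVec (fun i j => (h.contDiffOn_A i j).comp hcoord hmaps) fun t ht =>
      (hc.1.contDiffAt_velocity hφ ht).contDiffWithinAt).add (h.contDiffOn_b.comp hcoord hmaps)
  refine ⟨p, hpsmooth, fun t ht => ⟨hleg t ht, fun i => ?_⟩⟩
  have ht' : c t ∈ φ.source := ht
  -- Along the curve `Φ(r) = ċ - σ(L̂ ċ) + σ(L̂ ċ) = ċ`.
  have hΦ : coordJet φ (fun q => (Γ₀ q).add (-σ q (legendre L q (Γ₀ q)))) (φ (c t)) +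
      S (φ (c t)) *ᵥ p t = w t := by
    rw [coordJet_apply ht', JetFibre.velCoord_add, Submodule.coe_neg, map_neg, hleg t ht',
      hS _ ht', hvel t ht', neg_add_cancel_right]
  constructor
  -- The correction term vanishes because `p = A w + b` holds along the curve by definition of `p`.
  · rw [h.partialDeriv_coordHamiltonian hφ hS hS' hΓ (φ.map_source ht'), hΦ, sub_self,
      Matrix.mulVec_zero, add_zero]
    have hd : DifferentiableAt ℝ (fun τ => (φ (c τ)).2) t :=
      ((hc.1.contDiffAt_coord hφ ht').differentiableAt (by simp)).snd
    exact (hasDerivAt_pi.mp hd.hasDerivAt i).deriv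
  · have h1 := hc.1.coord_eq hφ ht'
    -- The momentum is `∂𝓛/∂q^i_t` along `c`, so its time derivative is the left side of the
    -- Lagrange equations.
    have h2 : deriv (fun s => p s i) t = deriv (fun s => partialDeriv (coordLagrangian L φ
        (φ (c s))) i (deriv (fun τ => (φ (c τ)).2) s)) t := by
      refine Filter.EventuallyEq.deriv_eq ?_
      filter_upwards [hc.1.eventually_mem φ.open_source ht'] with s hs
      exact (h.partialDeriv_coordLagrangian hφ (φ.map_source hs) _ i).symm
    have hp : A (φ (c t)) *ᵥ w t + b (φ (c t)) = p t := rfl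
    have hx₀ := φ.map_source ht'
    rw [h1] at hΦ hp hx₀
    rw [h2, hc.2 φ hφ t ht' i,
      h.partialDeriv_coordHamiltonian_base hφ hS hS' hΓ hx₀ hΦ hp i, neg_neg]

end Completeness

/-! ### The main theorem. -/

theorem mainTheorem1 (m : ℕ) {Q : Type*} [TopologicalSpace Q] [T2Space Q]
    [SecondCountableTopology Q] [ChartedSpace (Coord m) Q] [IsManifold 𝓘(ℝ, Coord m) ∞ Q]
    {M : Type*} [TopologicalSpace M] [ChartedSpace (Fin m → ℝ) M]
    [IsManifold 𝓘(ℝ, Fin m → ℝ) ∞ M]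
    (π : Q → ℝ) (hπ : IsSmoothFibreBundle m M π)
    (L : Lagrangian m π) (a : ∀ q : Q, Vert m π q →ₗ[ℝ] MomFibre m π q)
    (hL : IsQuadratic L a)
    (hrank : ∃ k : ℕ, ∀ q : Q, Module.finrank ℝ (LinearMap.range (a q)) = k)
    (hzero : ∀ q : Q, (0 : MomFibre m π q) ∈ constraintSpace L q) :
    (∃ σ : ∀ q : Q, MomFibre m π q →ₗ[ℝ] Vert m π q, IsSigmaMap L a σ ∧
      ∀ (q : Q) (z z' : MomFibre m π q), z' (σ q z) = z (σ q z')) ∧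
    (∃ Γ : ∀ q : Q, JetFibre m π q, IsKernelConnection L Γ) ∧
    ∀ σ : ∀ q : Q, MomFibre m π q →ₗ[ℝ] Vert m π q, IsSigmaMap L a σ →
      (∀ Γ : ∀ q : Q, JetFibre m π q, IsKernelConnection L Γ →
        IsWeaklyAssociated L (formOfMap L (affineMap Γ σ))) ∧
      IsCompleteSet L {H | ∃ Γ : ∀ q : Q, JetFibre m π q, IsKernelConnection L Γ ∧
        H = formOfMap L (affineMap Γ σ)} := by
  have hchart := hπ.exists_isBundleChart
  obtain ⟨k, hk⟩ := hrank
  have hrange (q : Q) (z : MomFibre m π q) (hz : z ∈ constraintSpace L q) : ∃ v, a q v = z := by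
    obtain ⟨φ, hφ, hq⟩ := hchart q
    exact (hL.mem_constraintSpace_iff hφ hq (hzero q) z).mp hz
  obtain ⟨σ₀, hσ₀, hσ₀'⟩ := hL.exists_smooth_symmGeneralizedInverse hk hchart
  have hσ₀'' : IsSigmaMap L a σ₀ := ⟨hσ₀, fun q z hz => by
    obtain ⟨v, rfl⟩ := hrange q z hz
    exact (hσ₀' q).1 v⟩
  refine ⟨⟨σ₀, hσ₀'', fun q => (hσ₀' q).2⟩, ?_, fun σ hσ =>
    ⟨fun Γ hΓ => hΓ.isWeaklyAssociated hL hchart hσ, fun c hc => ?_⟩⟩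
  · obtain ⟨Γ, hΓ⟩ := exists_isConnection hchart
    exact ⟨_, hΓ.isKernelConnection_sub hL hchart hσ₀''⟩
  · obtain ⟨Γ, hΓ, hΓc⟩ := hc.1.exists_isConnection_extending hchart
    -- The prescribed `σ`, not the symmetric `σ₀`, is used here: the form must belong to the family
    -- with this fixed `σ`.
    have hK := hΓ.isKernelConnection_sub hL hchart hσ
    exact ⟨_, ⟨_, hK, rfl⟩, hc.exists_isHamiltonSolution hL hσ.1 hΓc hK.1⟩
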